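/- Let $\theta>0$ and let $a,b>-1$ be real with $a+b>-1$; let $N\ge 0$ be an integer. For $z\in\mathbb R^N$ write $\Delta(z)=\prod_{1\le j<k\le N}(z_k-z_j)$ and $z^\theta=(z_1^\theta,\dots,z_N^\theta)$. The $\theta$-deformed Cauchy–Laguerre two-matrix model consists of $N$ particles $x_1,\dots,x_N>0$ of one kind and $N$ particles $y_1,\dots,y_N>0$ of a second kind, with unnormalised density $$p(x,y)=\prod_{j=1}^N x_j^ae^{-x_j}y_j^be^{-y_j}\;\frac{\Delta(x)\Delta(y)}{\prod_{j,k=1}^N(x_j+y_k)}\;\Delta(x^\theta)\Delta(y^\theta)\quad\text{on }\mathbb R_+^N\times\mathbb R_+^N ,$$ and partition function $Z_N=\frac1{(N!)^2}\int_{\mathbb R_+^N\times\mathbb R_+^N}p(x,y)\,dx\,dy$. For $0\le r,s\le N$ its $(r,s)$-correlation function is $$\rho_{r,s}(x_1,\dots,x_r;y_1,\dots,y_s)=\frac{\prod_{j=1}^r x_j^ae^{-x_j}\prod_{j=1}^s y_j^be^{-y_j}}{(N-r)!\,(N-s)!\,Z_N}\int_{\mathbb R_+^{N-r}\times\mathbb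 R_+^{N-s}}\Delta(x^\theta)\Delta(y^\theta)\det\Big[\frac1{x_i+y_j}\Big]_{i,j=1}^N\prod_{j=r+1}^N x_j^ae^{-x_j}dx_j\prod_{j=s+1}^N y_j^be^{-y_j}dy_j .$$ Let $h_n=\frac{\theta}{2n\theta+a+b+1}$. A pair of families of real polynomials $(\hat P_n)_{n\ge0}$, $(\hat Q_n)_{n\ge0}$ with $\deg\hat P_n=\deg\hat Q_n=n$ is called $\theta$-deformed Cauchy bi-orthogonal if $$\iint_{\mathbb R_+^2}\frac{e^{-(x+y)}}{x+y}x^ay^b\hat P_n(x^\theta)\hat Q_m(y^\theta)\,dx\,dy=\frac{h_n}{\theta}\delta_{n,m}\qquad(n,m\ge0).$$ For such a pair define the Christoffel–Darboux kernel $K_{00}(x,y)=K_N(x,y)=\sum_{n=0}^{N-1}\frac{\theta}{h_n}\hat P_n(x^\theta)\hat Q_n(y^\theta)$ and its Cauchy transforms $$K_{01}(x,x')=\int_{\mathbb R_+}\frac{K_N(x,y)}{x'+y}y^be^{-y}dy,\qquad K_{10}(y,y')=\int_{\mathbb R_+}\frac{K_N(x,y')}{x+y}x^ae^{-x}dx,$$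 $$K_{11}(y,x)=\int_{\mathbb R_+^2}\frac{K_N(x',y')}{(x'+y)(x+y')}x'^ay'^be^{-(x'+y')}dx'dy'-\frac1{x+y}.$$ Then the following hold. 1. $p\ge0$, and $p/((N!)^2Z_N)$ is a probability density on $\mathbb R_+^N\times\mathbb R_+^N$. 2. With $\alpha=\frac{a+b+1}{\theta}-1$ and $c_{n,l}=\frac{(-1)^l\,\Gamma(\alpha+n+l+1)}{l!\,(n-l)!\,\Gamma(\alpha+l+1)}$, the polynomials $\hat P_n(x)=\sum_{l=0}^n\frac{c_{n,l}\,x^l}{\Gamma(a+\theta l+1)}$ and $\hat Q_n(y)=\sum_{l=0}^n\frac{c_{n,l}\,y^l}{\Gamma(b+\theta l+1)}$ are $\theta$-deformed Cauchy bi-orthogonal. 3. For every $\theta$-deformed Cauchy bi-orthogonal pair, the integrals defining $K_{01},K_{10},K_{11}$ converge absolutely for positive arguments, and for all $0\le r,s\le N$: the integral defining $\rho_{r,s}$ converges absolutely at all positive arguments; $\rho_{r,s}$ is the $(r,s)$-correlation function of the point process, i.e. for every measurable $f:\mathbb R^r\times\mathbb R^s\to[0,\infty]$, with expectation over the law of the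 model, $$\mathbb E\sum_{\substack{i_1,\dots,i_r\ \text{distinct}\\ j_1,\dots,j_s\ \text{distinct}}}f(x_{i_1},\dots,x_{i_r};y_{j_1},\dots,y_{j_s})=\int_{\mathbb R_+^r\times\mathbb R_+^s}f\,\rho_{r,s}\,dx\,dy ;$$ and, for all $x_1,\dots,x_r,y_1,\dots,y_s>0$, $$\rho_{r,s}(x_1,\dots,x_r;y_1,\dots,y_s)=\prod_{i=1}^r x_i^ae^{-x_i}\prod_{j=1}^s y_j^be^{-y_j}\;\det\begin{bmatrix}[K_{01}(x_i,x_j)]_{i,j=1}^r&[K_{00}(x_i,y_j)]_{1\le i\le r}^{1\le j\le s}\\ [K_{11}(y_i,x_j)]_{1\le i\le s}^{1\le j\le r}&[K_{10}(y_i,y_j)]_{i,j=1}^s\end{bmatrix}.$$ Thus the model is a two-component determinantal point process. -/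

import Mathlib

open MeasureTheory

noncomputable section

namespace CauchyLaguerre

/-- The open positive orthant of `ℝⁿ`. -/
def posOrthant (n : ℕ) : Set (Fin n → ℝ) := {x | ∀ i, 0 < x i}

/-- The Laguerre weight `x ^ c * e ^ (-x)`. -/
def weight (c x : ℝ) : ℝ := x ^ c * Real.exp (-x)

/-- The product of differences `∏_{j < k} (z_k - z_j)`. -/
def prodDiff {N : ℕ} (z : Fin N → ℝ) : ℝ := ∏ j, ∏ k ∈ Finset.Ioi j, (z k - z j)

/-- The unnormalised eigenvalue density of the θ-deformed Cauchy–Laguerre two-matrix model. -/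
def density {N : ℕ} (a b θ : ℝ) (x y : Fin N → ℝ) : ℝ :=
  (∏ j, weight a (x j) * weight b (y j)) *
    (prodDiff x * prodDiff y / ∏ j, ∏ k, (x j + y k)) *
    (prodDiff (fun j => x j ^ θ) * prodDiff (fun j => y j ^ θ))

/-- The partition function `Z_N(a, b; θ)`. -/
def partitionFunction (N : ℕ) (a b θ : ℝ) : ℝ :=
  (1 / (N.factorial : ℝ)) ^ 2 *
    ∫ z in posOrthant N ×ˢ posOrthant N, density a b θ z.1 z.2

/-- The law of the labelled particles `(x, y) ∈ ℝ₊^N × ℝ₊^N`: the normalised density is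
`density / ((N!)² Z_N)`. -/
def law (N : ℕ) (a b θ : ℝ) : Measure ((Fin N → ℝ) × (Fin N → ℝ)) :=
  (volume.restrict (posOrthant N ×ˢ posOrthant N)).withDensity fun z =>
    ENNReal.ofReal
      (density a b θ z.1 z.2 / ((N.factorial : ℝ) ^ 2 * partitionFunction N a b θ))

/-- The `N`-tuple `(x_1, …, x_r, x_{r+1}, …, x_N)` from its first `r` and last `N - r` entries. -/
def joinVars {r N : ℕ} (hr : r ≤ N) (x : Fin r → ℝ) (x' : Fin (N - r) → ℝ) : Fin N → ℝ :=
  fun i => Fin.append x x' (Fin.cast (Nat.add_sub_cancel' hr).symm i)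

/-- The integrand, in the variables `x_{r+1}, …, x_N, y_{s+1}, …, y_N`, of the
`(r, s)`-correlation function. -/
def correlationIntegrand {N r s : ℕ} (a b θ : ℝ) (hr : r ≤ N) (hs : s ≤ N)
    (x : Fin r → ℝ) (y : Fin s → ℝ) (z : (Fin (N - r) → ℝ) × (Fin (N - s) → ℝ)) : ℝ :=
  (∏ j, weight a (z.1 j)) * (∏ j, weight b (z.2 j)) *
    (prodDiff (fun i => joinVars hr x z.1 i ^ θ) * prodDiff (fun j => joinVars hs y z.2 j ^ θ) *
      (Matrix.of fun i j : Fin N => 1 / (joinVars hr x z.1 i + joinVars hs y z.2 j)).det)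

/-- The `(r, s)`-correlation function `ρ_{r,s}(x_1, …, x_r; y_1, …, y_s)`. -/
def correlation {N r s : ℕ} (a b θ : ℝ) (hr : r ≤ N) (hs : s ≤ N)
    (x : Fin r → ℝ) (y : Fin s → ℝ) : ℝ :=
  (∏ j, weight a (x j)) * (∏ j, weight b (y j)) /
      (((N - r).factorial : ℝ) * ((N - s).factorial : ℝ) * partitionFunction N a b θ) *
    ∫ z in posOrthant (N - r) ×ˢ posOrthant (N - s), correlationIntegrand a b θ hr hs x y z

/-- `ρ` is an `(r, s)`-correlation function of the two-component point process on `ℝ₊` given by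
the law `μ` of `N` particles of each kind: the density of its `(r, s)` factorial moment measure. -/
def IsCorrelationFunction {N : ℕ} (μ : Measure ((Fin N → ℝ) × (Fin N → ℝ))) (r s : ℕ)
    (ρ : (Fin r → ℝ) → (Fin s → ℝ) → ℝ) : Prop :=
  ∀ f : (Fin r → ℝ) × (Fin s → ℝ) → ENNReal, Measurable f →
    ∫⁻ z, ∑ σ : Fin r ↪ Fin N, ∑ τ : Fin s ↪ Fin N, f (z.1 ∘ σ, z.2 ∘ τ) ∂μ =
      ∫⁻ w in posOrthant r ×ˢ posOrthant s, f w * ENNReal.ofReal (ρ w.1 w.2)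

/-- The normalisation `h_n = θ / (2 n θ + a + b + 1)`. -/
def hNorm (a b θ : ℝ) (n : ℕ) : ℝ := θ / (2 * n * θ + a + b + 1)

/-- `P`, `Q` are families of θ-deformed Cauchy bi-orthogonal polynomials with Laguerre weight. -/
def IsCauchyBiorthogonal (a b θ : ℝ) (P Q : ℕ → Polynomial ℝ) : Prop :=
  (∀ n, (P n).natDegree = n ∧ (Q n).natDegree = n) ∧
    ∀ n m, ∫ z in Set.Ioi (0 : ℝ) ×ˢ Set.Ioi (0 : ℝ),
        Real.exp (-(z.1 + z.2)) / (z.1 + z.2) * z.1 ^ a * z.2 ^ b *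
          (P n).eval (z.1 ^ θ) * (Q m).eval (z.2 ^ θ) =
      if n = m then hNorm a b θ n / θ else 0

/-- The parameter `α = (a + b + 1) / θ - 1`. -/
def alphaParam (a b θ : ℝ) : ℝ := (a + b + 1) / θ - 1

/-- The Jacobi coefficients `c_{n,l}`. -/
def jacobiCoeff (α : ℝ) (n l : ℕ) : ℝ :=
  Real.Gamma (α + n + l + 1) /
    ((l.factorial : ℝ) * ((n - l).factorial : ℝ) * Real.Gamma (α + l + 1)) * (-1) ^ l

/-- The explicit polynomial `P̂_n`. -/
def PHat (a b θ : ℝ) (n : ℕ) : Polynomial ℝ :=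
  ∑ l ∈ Finset.range (n + 1), Polynomial.monomial l
    (jacobiCoeff (alphaParam a b θ) n l / Real.Gamma (a + θ * l + 1))

/-- The explicit polynomial `Q̂_n`. -/
def QHat (a b θ : ℝ) (n : ℕ) : Polynomial ℝ :=
  ∑ l ∈ Finset.range (n + 1), Polynomial.monomial l
    (jacobiCoeff (alphaParam a b θ) n l / Real.Gamma (b + θ * l + 1))

section Kernels

variable (a b θ : ℝ) (P Q : ℕ → Polynomial ℝ) (N : ℕ)

/-- The Christoffel–Darboux kernel `K_N = K_{00}`. -/
def K00 (x y : ℝ) : ℝ :=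
  ∑ n ∈ Finset.range N, θ / hNorm a b θ n * (P n).eval (x ^ θ) * (Q n).eval (y ^ θ)

/-- The integrand of `K_{01}(x, x')`. -/
def K01Integrand (x x' y : ℝ) : ℝ := K00 a b θ P Q N x y / (x' + y) * weight b y

/-- The integrand of `K_{10}(y, y')`. -/
def K10Integrand (y y' x : ℝ) : ℝ := K00 a b θ P Q N x y' / (x + y) * weight a x

/-- The integrand of `K_{11}(y, x)`; the integration variable is `z = (x', y')`. -/
def K11Integrand (y x : ℝ) (z : ℝ × ℝ) : ℝ :=
  K00 a b θ P Q N z.1 z.2 / ((z.1 + y) * (x + z.2)) * (weight a z.1 * weight b z.2)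

def K01 (x x' : ℝ) : ℝ := ∫ y in Set.Ioi (0 : ℝ), K01Integrand a b θ P Q N x x' y

def K10 (y y' : ℝ) : ℝ := ∫ x in Set.Ioi (0 : ℝ), K10Integrand a b θ P Q N y y' x

def K11 (y x : ℝ) : ℝ :=
  (∫ z in Set.Ioi (0 : ℝ) ×ˢ Set.Ioi (0 : ℝ), K11Integrand a b θ P Q N y x z) - 1 / (x + y)

/-- The `(r + s) × (r + s)` block matrix of kernels. -/
def kernelMatrix {r s : ℕ} (x : Fin r → ℝ) (y : Fin s → ℝ) :
    Matrix (Fin r ⊕ Fin s) (Fin r ⊕ Fin s) ℝ :=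
  Matrix.fromBlocks
    (Matrix.of fun i j => K01 a b θ P Q N (x i) (x j))
    (Matrix.of fun i j => K00 a b θ P Q N (x i) (y j))
    (Matrix.of fun i j => K11 a b θ P Q N (y i) (x j))
    (Matrix.of fun i j => K10 a b θ P Q N (y i) (y j))

/-- The integrals defining `K_{01}`, `K_{10}`, `K_{11}` converge absolutely on `ℝ₊`. -/
def KernelsConverge : Prop :=
  ∀ u v : ℝ, 0 < u → 0 < v →
    IntegrableOn (K01Integrand a b θ P Q N u v) (Set.Ioi 0) ∧
    IntegrableOn (K10Integrand a b θ P Q N u v) (Set.Ioi 0) ∧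
    IntegrableOn (K11Integrand a b θ P Q N u v) (Set.Ioi (0 : ℝ) ×ˢ Set.Ioi (0 : ℝ))

end Kernels

end CauchyLaguerre

end

/-! Put `p n x = (θ / h_n) P_n(x^θ) x^a e^{-x}`, `q n y = Q_n(y^θ) y^b e^{-y}` and `C x y = 1 / (x +
y)`, so that bi-orthogonality reads `∬ p_n C q_m = δ_{nm}`. By the Cauchy determinant and column
operations on Vandermonde matrices, the density is a constant times `det[p_n(x_i)] det[q_n(y_i)]
det[C(x_i, y_j)]`. This product is exactly the determinant `D` of the block kernel matrix for all
`2N` particles (`BiorthogonalSystem.D_fin`), because that matrix is a product of two block matrices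
built from `p`, `q`, `C` and the transforms `A_n = ∫ p_n C dx`, `B_n = ∫ q_n C dy`.

The kernels reproduce themselves. Expanding `D` along the row and column of one variable of the
first kind (`det_fromBlocks_border`) and integrating that variable out, the diagonal entry
contributes `N · D`. Each remaining variable of the same kind contributes `-D`, and those of the
other kind contribute nothing, thanks to the term `-C` in the lower left block. With `r` variables
left the factor is thus `N - r`, and iteration gives `(N-r)! (N-s)!` (`integral_prod_D_sumElim`).
The case `r = s = 0` fixes the normalisation and, the density being nonnegative, the sign of the
constant.

Fubini is justified by the bound `1 / (x + y) ≤ x^{-s} y^{s-1}` for a suitable `s` in `[0, 1]`,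
which dominates every integrand by a product of integrable functions of one variable.

For the explicit polynomials, `e^{-u} / u = ∫_1^∞ e^{-tu} dt` gives the moments `Γ(A+1) Γ(B+1) /
(A+B+1)`. The Gamma factors cancel, leaving a double sum of Jacobi coefficients over `α + 1 + l +
k`, which is evaluated by partial fractions. -/

noncomputable section
namespace CauchyLaguerre

open Matrix Polynomial

/-! ### Determinants: bordered, Vandermonde, Cauchy -/

/-- Determinant of a bordered matrix in terms of the adjugate. -/
theorem det_fromBlocks_border {n R : Type*} [Fintype n] [DecidableEq n] [CommRing R]
    (A : Matrix n n R) (c r : n → R) (d : R) :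
    (fromBlocks A (replicateCol Unit c) (replicateRow Unit r) (of fun _ _ => d)).det =
      d * A.det - r ⬝ᵥ (A.adjugate *ᵥ c) := by
  -- After multiplication by `A.det`, a block column operation with `A.adjugate *ᵥ c` clears the
  -- last column. The extra factor is cancelled below by moving to a ring where it is regular.
  have key : ∀ (S : Type _) [CommRing S] (A : Matrix n n S) (c r : n → S) (d : S),
      A.det * (fromBlocks A (replicateCol Unit c) (replicateRow Unit r) (of fun _ _ => d)).det =
      A.det * (d * A.det - r ⬝ᵥ (A.adjugate *ᵥ c)) := by
    intro S _ A c r d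
    have h : fromBlocks A (replicateCol Unit c) (replicateRow Unit r) (of fun _ _ => d) *
        fromBlocks 1 (replicateCol Unit (-(A.adjugate *ᵥ c))) 0 (of fun _ _ => A.det) =
        fromBlocks A 0 (replicateRow Unit r) (of fun _ _ => d * A.det - r ⬝ᵥ (A.adjugate *ᵥ c)) := by
      rw [fromBlocks_multiply]
      congr 1
      · simp
      · ext i j
        have : (A *ᵥ (A.adjugate *ᵥ c)) i = A.det * c i := by
          rw [mulVec_mulVec, mul_adjugate, smul_mulVec, one_mulVec]; rfl
        have h2 : (A * replicateCol Unit (-(A.adjugate *ᵥ c))) i j = - (A.det * c i) := by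
          rw [← this]
          exact congrFun (mulVec_neg (A.adjugate *ᵥ c) A) i
        rw [Matrix.add_apply, h2]
        simp [Matrix.mul_apply, mul_comm]
      · simp
      · ext i j
        simp [Matrix.mul_apply, dotProduct, sub_eq_add_neg, add_comm]
    have h2 := congrArg det h
    rw [det_mul, det_fromBlocks_zero₂₁, det_fromBlocks_zero₁₂] at h2
    simp only [det_one, one_mul, det_unique, of_apply] at h2
    rw [mul_comm, h2]
  -- pass to `X + A` over `R[X]`, whose determinant is monic
  let A' : Matrix n n R[X] := charmatrix (-A)
  let φ : R[X] →+* R := Polynomial.evalRingHom 0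
  have hreg : IsLeftRegular A'.det := (Matrix.charpoly_monic (-A)).isRegular.left
  have h := hreg (key R[X] A' (fun i => Polynomial.C (c i)) (fun i => Polynomial.C (r i))
    (Polynomial.C d))
  have hA : φ.mapMatrix A' = A := by
    ext i j
    by_cases hij : i = j
    · subst hij; simp [A', φ, charmatrix_apply_eq]
    · simp [A', φ, charmatrix_apply_ne _ _ _ hij]
  have h3 := congrArg φ h
  rw [map_sub, map_mul, RingHom.map_det, RingHom.map_det, hA] at h3
  have e1 : φ.mapMatrix (fromBlocks A' (replicateCol Unit fun i => Polynomial.C (c i))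
      (replicateRow Unit fun i => Polynomial.C (r i)) (of fun _ _ => Polynomial.C d)) =
      fromBlocks A (replicateCol Unit c) (replicateRow Unit r) (of fun _ _ => d) := by
    conv_rhs => rw [← hA]
    ext (i | i) (j | j) <;> simp [φ]
  rw [e1] at h3
  rw [h3]
  congr 1
  · simp [φ]
  · simp only [dotProduct, mulVec, map_sum, map_mul]
    have : ∀ i j, φ (A'.adjugate i j) = A.adjugate i j := by
      intro i j
      have := congrFun (congrFun (φ.map_adjugate A') i) j
      rw [hA] at this
      exact this
    simp [this, φ]

theorem prodDiff_eq_det_vandermonde {N : ℕ} (z : Fin N → ℝ) :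
    prodDiff z = (vandermonde z).det := by
  rw [det_vandermonde]; rfl

/-- Evaluating polynomials `p j` of degree at most `j` at points gives a multiple of the
Vandermonde determinant. -/
theorem det_eval_eq_prod_coeff_mul_prodDiff {N : ℕ} (z : Fin N → ℝ) (p : Fin N → ℝ[X])
    (hp : ∀ i, (p i).natDegree ≤ i) :
    (of fun i j => (p j).eval (z i)).det = (∏ i, (p i).coeff i) * prodDiff z := by
  rw [prodDiff_eq_det_vandermonde, mul_comm,
    eval_matrixOfPolynomials_eq_vandermonde_mul_matrixOfPolynomials z p hp, det_mul]
  congr 1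
  refine det_of_isUpperTriangular (M := of fun i j : Fin N => (p j).coeff i) fun i j hij => ?_
  exact coeff_eq_zero_of_natDegree_lt (lt_of_le_of_lt (hp j) hij)

theorem prod_offDiag_eq {N : ℕ} (f : Fin N → Fin N → ℝ) :
    ∏ j, ∏ k ∈ Finset.univ.erase j, f j k =
      (∏ j, ∏ k ∈ Finset.Ioi j, f j k) * ∏ j, ∏ k ∈ Finset.Ioi j, f k j := by
  have h : ∀ j : Fin N, Finset.univ.erase j = Finset.Ioi j ∪ Finset.Iio j := by
    intro j; ext k; simp [lt_or_lt_iff_ne, ne_comm]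
  have h2 : ∏ j : Fin N, ∏ k ∈ Finset.Iio j, f j k = ∏ j, ∏ k ∈ Finset.Ioi j, f k j := by
    apply Finset.prod_comm'
    simp
  rw [← h2, ← Finset.prod_mul_distrib]
  refine Finset.prod_congr rfl fun j _ => ?_
  rw [h, Finset.prod_union]
  rw [Finset.disjoint_left]
  intro k hk hk'
  simp only [Finset.mem_Ioi, Finset.mem_Iio] at hk hk'
  exact lt_asymm hk hk'

/-- The Cauchy determinant. -/
theorem det_cauchy {N : ℕ} (x y : Fin N → ℝ) (h : ∀ i j, x i + y j ≠ 0) :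
    (of fun i j => 1 / (x i + y j)).det =
      prodDiff x * prodDiff y / ∏ j, ∏ k, (x j + y k) := by
  by_cases hy : Function.Injective y
  swap
  · obtain ⟨i, j, hij, hne⟩ : ∃ i j, y i = y j ∧ i ≠ j := by
      simpa [Function.Injective] using hy
    rw [det_zero_of_column_eq hne (by intro k; simp [hij]), prodDiff_eq_det_vandermonde y,
      det_zero_of_row_eq (M := vandermonde y) hne (by ext k; simp [vandermonde_apply, hij])]
    simp
  -- The polynomials `∏_{k ≠ j} (X + y_k)` have degree `N - 1`, so their values at `z` form a
  -- Vandermonde matrix times a coefficient matrix independent of `z`.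
  have hG : ∀ z : Fin N → ℝ, (of fun i j => ∏ k ∈ Finset.univ.erase j, (z i + y k)).det =
      (vandermonde z).det * (of fun i j : Fin N =>
        (∏ k ∈ Finset.univ.erase j, (X + Polynomial.C (y k))).coeff i).det := by
    intro z
    rw [← det_mul]
    congr 1
    ext i j
    simp only [of_apply, Matrix.mul_apply, vandermonde_apply]
    have : ∏ k ∈ Finset.univ.erase j, (z i + y k) =
        (∏ k ∈ Finset.univ.erase j, (X + Polynomial.C (y k))).eval (z i) := by
      simp [eval_prod]
    rw [this, eval_eq_sum_range' (n := N)]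
    · rw [Finset.sum_range]
      simp [mul_comm]
    · have hN : 0 < N := j.pos
      rw [natDegree_prod_of_monic _ _ fun k _ => monic_X_add_C _]
      simp
      omega
  have hny : (of fun i j => ∏ k ∈ Finset.univ.erase j, (-y i + y k)).det =
      ∏ j, ∏ k ∈ Finset.univ.erase j, (-y j + y k) := by
    rw [← det_diagonal]
    congr 1
    ext i j
    by_cases hij : i = j
    · subst hij; simp
    · rw [diagonal_apply_ne _ hij, of_apply]
      exact Finset.prod_eq_zero (i := i) (by simp [hij]) (by simp)
  -- At `z = -y` the matrix of values is diagonal. Cancelling the Vandermonde determinant of `-y`,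
  -- nonzero as `y` is injective, identifies the coefficient determinant with `prodDiff y`.
  have hg := hG (-y)
  simp only [Pi.neg_apply] at hg
  rw [hny, prod_offDiag_eq, det_vandermonde] at hg
  simp only [Pi.neg_apply] at hg
  have hne : (∏ i : Fin N, ∏ j ∈ Finset.Ioi i, (-y j - -y i)) ≠ 0 := by
    rw [Finset.prod_ne_zero_iff]; intro i _
    rw [Finset.prod_ne_zero_iff]; intro j hj h0
    have : y i = y j := by linarith
    exact (Finset.mem_Ioi.1 hj).ne (hy this)
  have hg2 : prodDiff y = (of fun i j : Fin N =>
        (∏ k ∈ Finset.univ.erase j, (X + Polynomial.C (y k))).coeff i).det := by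
    apply mul_left_cancel₀ hne
    rw [← hg, mul_comm]
    congr 1
    · refine Finset.prod_congr rfl fun j _ => Finset.prod_congr rfl fun k _ => by ring
    · refine Finset.prod_congr rfl fun j _ => Finset.prod_congr rfl fun k _ => by ring
  have hx := hG x
  rw [← hg2, ← prodDiff_eq_det_vandermonde] at hx
  -- Clearing denominators multiplies row `i` by `∏ k, (x i + y k)`, which turns the Cauchy matrix
  -- into the matrix of values in `hx`.
  rw [eq_div_iff (by simpa [Finset.prod_ne_zero_iff] using h), ← hx, mul_comm, ← det_mul_column]
  congr 1
  ext i j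
  simp only [of_apply]
  rw [← Finset.mul_prod_erase Finset.univ (fun k => x i + y k) (Finset.mem_univ j)]
  field_simp [h i j]

/-- Every term of the Leibniz expansion uses each row and each column once, so all have the same
product bound. -/
theorem abs_det_le_of_abs_le_mul {n : Type*} [Fintype n] [DecidableEq n] (M : Matrix n n ℝ)
    (g h : n → ℝ) (H : ∀ i j, |M i j| ≤ g i * h j) :
    |M.det| ≤ (Fintype.card n).factorial * ((∏ i, g i) * ∏ i, h i) := by
  rw [det_apply]
  refine (Finset.abs_sum_le_sum_abs _ _).trans ?_
  have : ∀ σ ∈ (Finset.univ : Finset (Equiv.Perm n)),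
      |Equiv.Perm.sign σ • ∏ i, M (σ i) i| ≤ (∏ i, g i) * ∏ i, h i := by
    intro σ _
    have h1 : |Equiv.Perm.sign σ • ∏ i, M (σ i) i| = ∏ i, |M (σ i) i| := by
      rcases Int.units_eq_one_or (Equiv.Perm.sign σ) with hs | hs <;>
        simp [hs, Finset.abs_prod]
    rw [h1, ← Equiv.prod_comp σ g, ← Finset.prod_mul_distrib]
    exact Finset.prod_le_prod (fun i _ => abs_nonneg _) fun i _ => H _ _
  refine (Finset.sum_le_card_nsmul _ _ _ this).trans (le_of_eq ?_)
  rw [Finset.card_univ, Fintype.card_perm, nsmul_eq_mul]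

theorem measurable_det {α n : Type*} [MeasurableSpace α] [Fintype n] [DecidableEq n]
    (M : α → Matrix n n ℝ) (h : ∀ i j, Measurable fun a => M a i j) :
    Measurable fun a => (M a).det := by
  simp_rw [det_apply']
  exact Finset.measurable_sum _ fun σ _ => (Finset.measurable_prod _ fun i _ => h _ _).const_mul _

/-! ### Bi-orthogonal systems and the reproducing property of their kernel determinants -/

/-- A finite bi-orthogonal system of functions for a kernel `C` dominated by a product. -/
structure BiorthogonalSystem (μ : Measure ℝ) (N : ℕ) where
  C : ℝ → ℝ → ℝ
  p : Fin N → ℝ → ℝ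
  q : Fin N → ℝ → ℝ
  φ : ℝ → ℝ
  ψ : ℝ → ℝ
  measurable_C : Measurable (Function.uncurry C)
  measurable_p : ∀ n, Measurable (p n)
  measurable_q : ∀ n, Measurable (q n)
  abs_C_le : ∀ x y, |C x y| ≤ φ x * ψ y
  integrable_p : ∀ n, Integrable (fun x => p n x * φ x) μ
  integrable_q : ∀ n, Integrable (fun y => q n y * ψ y) μ
  biorthogonal : ∀ n m, ∫ z, p n z.1 * C z.1 z.2 * q m z.2 ∂(μ.prod μ) = if n = m then 1 else 0

namespace BiorthogonalSystem

variable {μ : Measure ℝ} [SigmaFinite μ] {N : ℕ} (S : BiorthogonalSystem μ N)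

/-- The system with the two kinds of variables exchanged. -/
def swap : BiorthogonalSystem μ N where
  C x y := S.C y x
  p := S.q
  q := S.p
  φ := S.ψ
  ψ := S.φ
  measurable_C := S.measurable_C.comp measurable_swap
  measurable_p := S.measurable_q
  measurable_q := S.measurable_p
  abs_C_le x y := by rw [mul_comm]; exact S.abs_C_le y x
  integrable_p := S.integrable_q
  integrable_q := S.integrable_p
  biorthogonal n m := by
    rw [← integral_prod_swap]
    simp_rw [eq_comm (a := n), ← S.biorthogonal m n]
    refine integral_congr_ae (Filter.Eventually.of_forall fun z => ?_)
    simp only [Prod.fst_swap, Prod.snd_swap]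
    ring

/-- The transform `∫ p_n(x) C(x, y) dx`. -/
def A (n : Fin N) (y : ℝ) : ℝ := ∫ x, S.p n x * S.C x y ∂μ

/-- The transform `∫ q_n(y) C(x, y) dy`. -/
def B (n : Fin N) (x : ℝ) : ℝ := ∫ y, S.q n y * S.C x y ∂μ

omit [SigmaFinite μ] in
-- The bound on `C` holds at every point, so the transforms converge for every `y` and not merely
-- almost every one; the determinantal formula is pointwise.
theorem integrable_p_mul_C (n : Fin N) (y : ℝ) : Integrable (fun x => S.p n x * S.C x y) μ := by
  refine ((S.integrable_p n).mul_const (S.ψ y)).mono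
    ((S.measurable_p n).mul (S.measurable_C.comp (f := fun x => (x, y))
      (by fun_prop))).aestronglyMeasurable ?_
  refine Filter.Eventually.of_forall fun x => ?_
  simp only [Real.norm_eq_abs]
  rw [mul_assoc, abs_mul, abs_mul]
  exact mul_le_mul_of_nonneg_left ((S.abs_C_le x y).trans (le_abs_self _)) (abs_nonneg _)

theorem integrable_q_mul_C (n : Fin N) (x : ℝ) : Integrable (fun y => S.q n y * S.C x y) μ :=
  S.swap.integrable_p_mul_C n x

omit [SigmaFinite μ] in
theorem integrable_p_mul_C_mul_q (n m : Fin N) :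
    Integrable (fun z : ℝ × ℝ => S.p n z.1 * S.C z.1 z.2 * S.q m z.2) (μ.prod μ) := by
  refine ((S.integrable_p n).mul_prod (S.integrable_q m)).mono
    ((((S.measurable_p n).comp measurable_fst).mul S.measurable_C).mul
      ((S.measurable_q m).comp measurable_snd)).aestronglyMeasurable ?_
  refine Filter.Eventually.of_forall fun z => ?_
  simp only [Real.norm_eq_abs]
  have : S.p n z.1 * S.φ z.1 * (S.q m z.2 * S.ψ z.2) =
    S.p n z.1 * (S.φ z.1 * S.ψ z.2) * S.q m z.2 := by ring
  rw [this, abs_mul, abs_mul, abs_mul, abs_mul (S.p n z.1)]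
  exact mul_le_mul_of_nonneg_right (mul_le_mul_of_nonneg_left
    ((S.abs_C_le _ _).trans (le_abs_self _)) (abs_nonneg _)) (abs_nonneg _)

theorem integrable_p_mul_B (n m : Fin N) : Integrable (fun x => S.p n x * S.B m x) μ := by
  refine (S.integrable_p_mul_C_mul_q n m).integral_prod_left.congr
    (Filter.Eventually.of_forall fun x => ?_)
  simp only [B]
  rw [← integral_const_mul]
  exact integral_congr_ae (Filter.Eventually.of_forall fun y => by simp only; ring)

theorem integral_p_mul_B (n m : Fin N) :
    ∫ x, S.p n x * S.B m x ∂μ = if n = m then 1 else 0 := by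
  rw [← S.biorthogonal n m, integral_prod _ (S.integrable_p_mul_C_mul_q n m)]
  refine integral_congr_ae (Filter.Eventually.of_forall fun x => ?_)
  simp only [B]
  rw [← integral_const_mul]
  exact integral_congr_ae (Filter.Eventually.of_forall fun y => by simp only; ring)

section Kernel

variable {ι κ : Type*} [Fintype ι] [Fintype κ] [DecidableEq ι] [DecidableEq κ]

/-- The block matrix of the correlation kernels. -/
def kern (x : ι → ℝ) (y : κ → ℝ) : Matrix (ι ⊕ κ) (ι ⊕ κ) ℝ :=
  fromBlocks
    (of fun i j => ∑ n, S.p n (x i) * S.B n (x j))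
    (of fun i j => ∑ n, S.p n (x i) * S.q n (y j))
    (of fun i j => ∑ n, S.A n (y i) * S.B n (x j) - S.C (x j) (y i))
    (of fun i j => ∑ n, S.A n (y i) * S.q n (y j))

/-- The determinant of the block matrix of kernels. -/
def D (x : ι → ℝ) (y : κ → ℝ) : ℝ := (S.kern x y).det

omit [SigmaFinite μ] in
-- Relabelling the variables permutes rows and columns simultaneously, so no sign appears.
theorem D_comp_equiv {ι' κ' : Type*} [Fintype ι'] [Fintype κ'] [DecidableEq ι'] [DecidableEq κ']
    (x : ι → ℝ) (y : κ → ℝ) (e : ι' ≃ ι) (f : κ' ≃ κ) : S.D (x ∘ e) (y ∘ f) = S.D x y := by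
  unfold D
  rw [← det_submatrix_equiv_self (Equiv.sumCongr e f)]
  congr 1
  ext (i | i) (j | j) <;> rfl

/-- Transposition exchanges the roles of the two kinds, so everything proved for the first kind of
variable transfers to the second. -/
theorem swap_D (x : ι → ℝ) (y : κ → ℝ) : S.swap.D y x = S.D x y := by
  unfold D
  rw [← det_transpose (S.kern x y), ← det_submatrix_equiv_self (Equiv.sumComm κ ι)]
  congr 1
  ext (i | i) (j | j) <;> simp [kern, swap, A, B, mul_comm]

/-- The entries of the column of the kernel matrix belonging to an additional variable. -/
def borderCol (x : ι → ℝ) (y : κ → ℝ) (t : ℝ) : ι ⊕ κ → ℝ :=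
  Sum.elim (fun i => ∑ n, S.p n (x i) * S.B n t)
    (fun j => ∑ n, S.A n (y j) * S.B n t - S.C t (y j))

/-- The coefficients of the row of the kernel matrix belonging to an additional variable. -/
def rowCoeff (x : ι → ℝ) (y : κ → ℝ) (n : Fin N) : ι ⊕ κ → ℝ :=
  Sum.elim (fun i => S.B n (x i)) (fun j => S.q n (y j))

omit [Fintype ι] [Fintype κ] [DecidableEq ι] [DecidableEq κ] in
theorem integrable_p_mul_borderCol (x : ι → ℝ) (y : κ → ℝ) (m : Fin N) (i : ι ⊕ κ) :
    Integrable (fun t => S.p m t * S.borderCol x y t i) μ := by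
  rcases i with i | j
  · simp only [borderCol, Sum.elim_inl, Finset.mul_sum]
    refine integrable_finsetSum _ fun n _ => ?_
    refine ((S.integrable_p_mul_B m n).const_mul (S.p n (x i))).congr
      (Filter.Eventually.of_forall fun t => by simp only; ring)
  · simp only [borderCol, Sum.elim_inr, mul_sub, Finset.mul_sum]
    refine (integrable_finsetSum _ fun n _ => ?_).sub (S.integrable_p_mul_C m (y j))
    refine ((S.integrable_p_mul_B m n).const_mul (S.A n (y j))).congr
      (Filter.Eventually.of_forall fun t => by simp only; ring)

theorem integral_p_mul_sum_B (c : Fin N → ℝ) (m : Fin N) :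
    Integrable (fun t => S.p m t * ∑ n, c n * S.B n t) μ ∧
    ∫ t, S.p m t * ∑ n, c n * S.B n t ∂μ = c m := by
  have hi : ∀ n, Integrable (fun t => S.p m t * (c n * S.B n t)) μ := fun n =>
    ((S.integrable_p_mul_B m n).const_mul (c n)).congr
      (Filter.Eventually.of_forall fun t => by simp only; ring)
  simp only [Finset.mul_sum]
  refine ⟨integrable_finsetSum _ fun n _ => hi n, ?_⟩
  rw [integral_finsetSum _ fun n _ => hi n]
  have : ∀ n, ∫ t, S.p m t * (c n * S.B n t) ∂μ = if m = n then c n else 0 := by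
    intro n
    rw [← mul_boole, ← S.integral_p_mul_B m n, ← integral_const_mul]
    exact integral_congr_ae (Filter.Eventually.of_forall fun t => by simp only; ring)
  simp [this]

omit [Fintype ι] [Fintype κ] [DecidableEq ι] [DecidableEq κ] in
-- For a variable of the first kind this is reproduction. For one of the second kind, the sum over
-- `n` yields `A m (y j)` and the term `-C` subtracts the same quantity.
theorem integral_p_mul_borderCol (x : ι → ℝ) (y : κ → ℝ) (m : Fin N) (i : ι ⊕ κ) :
    ∫ t, S.p m t * S.borderCol x y t i ∂μ = Sum.elim (fun i => S.p m (x i)) (fun _ => 0) i := by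
  rcases i with i | j
  · simp only [borderCol, Sum.elim_inl]
    exact (S.integral_p_mul_sum_B (fun n => S.p n (x i)) m).2
  · simp only [borderCol, Sum.elim_inr, mul_sub]
    obtain ⟨h1, h2⟩ := S.integral_p_mul_sum_B (fun n => S.A n (y j)) m
    rw [integral_sub h1 (S.integrable_p_mul_C m (y j)), h2]
    simp [A]

omit [SigmaFinite μ] in
-- The new row depends on `t` only through the `p n t`, with coefficients `rowCoeff`, and the new
-- column only through `borderCol`. The integral over `t` thus reduces to integrals of `p n t *
-- borderCol x y t j`.
theorem D_sumElim_unit (x : ι → ℝ) (y : κ → ℝ) (t : ℝ) :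
    S.D (Sum.elim x fun _ : Unit => t) y =
      (∑ n, S.p n t * S.B n t) * S.D x y -
        (fun i => ∑ n, S.p n t * S.rowCoeff x y n i) ⬝ᵥ
          ((S.kern x y).adjugate *ᵥ S.borderCol x y t) := by
  unfold D
  rw [← det_fromBlocks_border]
  let e : (ι ⊕ κ) ⊕ Unit ≃ (ι ⊕ Unit) ⊕ κ :=
    (Equiv.sumAssoc ι κ Unit).trans (((Equiv.refl ι).sumCongr (Equiv.sumComm κ Unit)).trans
      (Equiv.sumAssoc ι Unit κ).symm)
  rw [← det_submatrix_equiv_self e]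
  congr 1
  ext ((i | i) | i) ((j | j) | j) <;>
    simp [e, kern, borderCol, rowCoeff, replicateCol, replicateRow]

/-- Integrating out one variable of the first kind. -/
theorem integral_D_sumElim_unit (x : ι → ℝ) (y : κ → ℝ) :
    ∫ t, S.D (Sum.elim x fun _ : Unit => t) y ∂μ = (N - Fintype.card ι) * S.D x y := by
  simp_rw [S.D_sumElim_unit x y]
  have h1 : Integrable (fun t => ∑ n, S.p n t * S.B n t) μ :=
    integrable_finsetSum _ fun n _ => S.integrable_p_mul_B n n
  have e1 : ∫ t, ∑ n, S.p n t * S.B n t ∂μ = N := by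
    rw [integral_finsetSum _ fun n _ => S.integrable_p_mul_B n n]
    simp [S.integral_p_mul_B]
  have h2 : ∀ t, (fun i => ∑ n, S.p n t * S.rowCoeff x y n i) ⬝ᵥ
      ((S.kern x y).adjugate *ᵥ S.borderCol x y t) =
      ∑ i, ∑ j, ∑ n, S.rowCoeff x y n i * (S.kern x y).adjugate i j *
        (S.p n t * S.borderCol x y t j) := by
    intro t
    simp only [dotProduct, mulVec, Finset.sum_mul, Finset.mul_sum]
    refine Finset.sum_congr rfl fun i _ => Finset.sum_congr rfl fun j _ => Finset.sum_congr rfl fun n _ => ?_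
    ring
  have h3 : ∀ (i j : ι ⊕ κ) (n : Fin N), Integrable (fun t => S.rowCoeff x y n i *
      (S.kern x y).adjugate i j * (S.p n t * S.borderCol x y t j)) μ := fun i j n =>
    (S.integrable_p_mul_borderCol x y n j).const_mul _
  simp_rw [h2]
  rw [integral_sub (h1.mul_const _) (integrable_finsetSum _ fun i _ => integrable_finsetSum _
    fun j _ => integrable_finsetSum _ fun n _ => h3 i j n), integral_mul_const, e1,
    integral_finsetSum _ fun i _ => integrable_finsetSum _
    fun j _ => integrable_finsetSum _ fun n _ => h3 i j n]
  simp_rw [integral_finsetSum _ fun j _ => integrable_finsetSum _ fun n _ => h3 _ j n,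
    integral_finsetSum _ fun n _ => h3 _ _ n, integral_const_mul, S.integral_p_mul_borderCol]
  rw [sub_mul]
  congr 1
  rw [Finset.sum_comm, Fintype.sum_sum_type]
  simp only [Sum.elim_inl, Sum.elim_inr, mul_zero, Finset.sum_const_zero, add_zero]
  -- Summing `p n (x j)` against `rowCoeff` rebuilds row `inl j` of the kernel matrix, whose product
  -- with column `inl j` of the adjugate is the determinant. Each `j : ι` therefore subtracts one
  -- copy of `D`.
  have h4 : ∀ j : ι, ∑ i, ∑ n, S.rowCoeff x y n i * (S.kern x y).adjugate i (Sum.inl j) *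
      S.p n (x j) = S.D x y := by
    intro j
    have := congrFun (congrFun (mul_adjugate (S.kern x y)) (Sum.inl j)) (Sum.inl j)
    rw [Matrix.mul_apply] at this
    simp only [Matrix.smul_apply, one_apply_eq, smul_eq_mul, mul_one] at this
    rw [D, ← this]
    refine Finset.sum_congr rfl fun i _ => ?_
    have h5 : S.kern x y (Sum.inl j) i = ∑ n, S.p n (x j) * S.rowCoeff x y n i := by
      rcases i with i | i <;> simp [kern, rowCoeff]
    rw [h5, Finset.sum_mul]
    exact Finset.sum_congr rfl fun n _ => by ring
  simp [h4]

end Kernel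

/-- Integrating out all variables of the first kind but some. -/
theorem integral_D_sumElim {κ : Type} [Fintype κ] [DecidableEq κ] (y : κ → ℝ) (k : ℕ) :
    ∀ (ι : Type) [Fintype ι] [DecidableEq ι] (x : ι → ℝ), Fintype.card ι + k = N →
      Integrable (fun x' : Fin k → ℝ => S.D (Sum.elim x x') y) (Measure.pi fun _ => μ) →
      ∫ x' : Fin k → ℝ, S.D (Sum.elim x x') y ∂(Measure.pi fun _ => μ) =
        k.factorial * S.D x y := by
  induction k with
  | zero =>
    intro ι _ _ x h _
    have : ∀ x' : Fin 0 → ℝ, S.D (Sum.elim x x') y = S.D x y := fun x' =>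
      S.D_comp_equiv x y (Equiv.sumEmpty ι (Fin 0)) (Equiv.refl κ) ▸ by
        congr 1
        ext (i | i)
        · rfl
        · exact i.elim0
    simp [this, measureReal_def]
  | succ k ih =>
    intro ι _ _ x h hint
    have hmp := (measurePreserving_piFinSuccAbove (fun _ : Fin (k + 1) => μ) 0).symm
    -- The first of the `k + 1` variables joins the frozen ones, so that the induction hypothesis
    -- integrates the other `k`.
    let e : (ι ⊕ Unit) ⊕ Fin k ≃ ι ⊕ Fin (k + 1) :=
      { toFun := Sum.elim (Sum.elim Sum.inl fun _ => Sum.inr 0) fun i => Sum.inr i.succ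
        invFun := Sum.elim (fun i => Sum.inl (Sum.inl i))
          (Fin.cases (Sum.inl (Sum.inr ())) fun i => Sum.inr i)
        left_inv := by rintro ((i | i) | i) <;> simp
        right_inv := by
          rintro (i | i)
          · simp
          · induction i using Fin.cases <;> simp }
    have hD : ∀ z : ℝ × (Fin k → ℝ),
        S.D (Sum.elim x ((MeasurableEquiv.piFinSuccAbove (fun _ => ℝ) 0).symm z)) y =
          S.D (Sum.elim (Sum.elim x fun _ : Unit => z.1) z.2) y := by
      intro z
      rw [← S.D_comp_equiv _ y e (Equiv.refl κ)]
      congr 1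
      ext ((i | i) | i) <;> simp [e, MeasurableEquiv.piFinSuccAbove]
    have hint' : Integrable (fun z : ℝ × (Fin k → ℝ) =>
        S.D (Sum.elim (Sum.elim x fun _ : Unit => z.1) z.2) y)
        (μ.prod (Measure.pi fun _ => μ)) := by
      have := (hmp.integrable_comp_emb (MeasurableEquiv.measurableEmbedding _)).2 hint
      exact this.congr (Filter.Eventually.of_forall hD)
    rw [← hmp.integral_comp (MeasurableEquiv.measurableEmbedding _)]
    simp_rw [hD]
    rw [integral_prod _ hint']
    -- Fubini makes the slices integrable only for almost every `t`, which suffices under the outer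
    -- integral.
    have hae : ∀ᵐ t ∂μ, ∫ x' : Fin k → ℝ,
        S.D (Sum.elim (Sum.elim x fun _ : Unit => t) x') y ∂(Measure.pi fun _ => μ) =
        k.factorial * S.D (Sum.elim x fun _ : Unit => t) y := by
      filter_upwards [hint'.prod_right_ae] with t ht
      exact ih (ι ⊕ Unit) _ (by simp; omega) ht
    rw [integral_congr_ae hae, integral_const_mul, S.integral_D_sumElim_unit]
    have hN : (N : ℝ) = Fintype.card ι + (k + 1) := by exact_mod_cast h.symm
    rw [hN]
    push_cast [Nat.factorial_succ]
    ring

/-- Integrating out all variables but some. -/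
theorem integral_prod_D_sumElim {ι κ : Type} [Fintype ι] [DecidableEq ι] [Fintype κ]
    [DecidableEq κ] (x : ι → ℝ) (y : κ → ℝ) {k l : ℕ} (hk : Fintype.card ι + k = N)
    (hl : Fintype.card κ + l = N)
    (hint : Integrable (fun z : (Fin k → ℝ) × (Fin l → ℝ) =>
      S.D (Sum.elim x z.1) (Sum.elim y z.2))
      ((Measure.pi fun _ => μ).prod (Measure.pi fun _ => μ))) :
    ∫ z : (Fin k → ℝ) × (Fin l → ℝ), S.D (Sum.elim x z.1) (Sum.elim y z.2)
      ∂((Measure.pi fun _ => μ).prod (Measure.pi fun _ => μ)) =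
      k.factorial * l.factorial * S.D x y := by
  have hae : ∀ᵐ y' : Fin l → ℝ ∂(Measure.pi fun _ => μ), ∫ x' : Fin k → ℝ,
      S.D (Sum.elim x x') (Sum.elim y y') ∂(Measure.pi fun _ => μ) =
        k.factorial * S.D x (Sum.elim y y') := by
    filter_upwards [hint.prod_left_ae] with y' hy'
    exact S.integral_D_sumElim _ k ι x hk hy'
  have hk0 : (k.factorial : ℝ) ≠ 0 := by positivity
  -- The inner integral is `k!` times this function, and Fubini makes the inner integral integrable.
  have h1 : Integrable (fun y' : Fin l → ℝ => S.D x (Sum.elim y y')) (Measure.pi fun _ => μ) := by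
    have := (hint.integral_prod_right.congr hae).const_mul ((k.factorial : ℝ)⁻¹)
    refine this.congr (Filter.Eventually.of_forall fun y' => ?_)
    simp only
    rw [inv_mul_cancel_left₀ hk0]
  rw [integral_prod_symm _ hint, integral_congr_ae hae, integral_const_mul]
  have := S.swap.integral_D_sumElim x l κ y hl
  simp_rw [S.swap_D] at this
  rw [this h1, mul_assoc]

omit [SigmaFinite μ] in
/-- With all `N` variables of both kinds the determinant factorises. -/
theorem D_fin (x y : Fin N → ℝ) :
    S.D x y = (of fun i n => S.p n (x i)).det * (of fun i n => S.q n (y i)).det *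
      (of fun i j => S.C (x i) (y j)).det := by
  have h1 : S.kern x y =
      fromBlocks (of fun i n => S.p n (x i)) 0 (of fun i n => S.A n (y i)) (-1) *
      fromBlocks (of fun n j => S.B n (x j)) (of fun n j => S.q n (y j))
        (of fun i j => S.C (x j) (y i)) 0 := by
    rw [fromBlocks_multiply]
    ext (i | i) (j | j) <;> simp [kern, Matrix.mul_apply, sub_eq_add_neg]
  -- The three unipotent factors multiply to the rotation with blocks `0, -1, 1, 0`. It exchanges
  -- the block columns at determinant one; the remaining two signs `(-1)^N` cancel.
  have h2 : fromBlocks (of fun n j => S.B n (x j)) (of fun n j => S.q n (y j))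
        (of fun i j => S.C (x j) (y i)) 0 *
        (fromBlocks 1 (-1) 0 1 * fromBlocks 1 0 1 1 * fromBlocks 1 (-1) 0 1) =
      fromBlocks (of fun n j => S.q n (y j)) (-(of fun n j => S.B n (x j))) 0
        (-(of fun i j => S.C (x j) (y i))) := by
    simp [fromBlocks_multiply]
  have h3 := congrArg det h2
  simp only [det_mul, det_fromBlocks_zero₂₁, det_fromBlocks_zero₁₂, det_one, mul_one, det_neg,
    Fintype.card_fin] at h3
  rw [D, h1, det_mul, h3, det_fromBlocks_zero₁₂, det_neg, det_one, Fintype.card_fin]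
  have h4 : (of fun n j => S.q n (y j)).det = (of fun i n => S.q n (y i)).det := by
    rw [← det_transpose]; rfl
  have h5 : (of fun i j => S.C (x j) (y i)).det = (of fun i j => S.C (x i) (y j)).det := by
    rw [← det_transpose]; rfl
  rw [h4, h5]
  have h6 : ((-1 : ℝ) ^ N) * (-1) ^ N = 1 := by rw [← mul_pow]; simp
  linear_combination ((of fun i n => S.p n (x i)).det * (of fun i n => S.q n (y i)).det *
      (of fun i j => S.C (x i) (y j)).det) * h6

/-- An integrable majorant of the weighted functions `p`. -/
def majorant (x : ℝ) : ℝ := ∑ n, |S.p n x * S.φ x|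

omit [SigmaFinite μ] in
theorem integrable_majorant : Integrable S.majorant μ :=
  integrable_finsetSum _ fun n _ => (S.integrable_p n).abs

omit [SigmaFinite μ] in
theorem abs_det_p_mul_prod_le (x : Fin N → ℝ) :
    |(of fun i n => S.p n (x i)).det * ∏ i, S.φ (x i)| ≤ N.factorial * ∏ i, S.majorant (x i) := by
  rw [mul_comm, ← det_mul_column]
  refine (abs_det_le_of_abs_le_mul _ (fun i => S.majorant (x i)) 1 fun i n => ?_).trans ?_
  · simp only [of_apply, Pi.one_apply, mul_one, majorant]
    rw [mul_comm]
    exact Finset.single_le_sum (f := fun n => |S.p n (x i) * S.φ (x i)|)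
      (fun _ _ => abs_nonneg _) (Finset.mem_univ n)
  · simp

/-- The bound on `det C` supplies factors `φ (x i)` and `ψ (y i)`, which are absorbed into the rows
of the `p` and `q` determinants. Each of the three determinants costs one `N!`. -/
theorem abs_D_fin_le (x y : Fin N → ℝ) :
    |S.D x y| ≤ N.factorial ^ 3 *
      ((∏ i, S.majorant (x i)) * ∏ i, S.swap.majorant (y i)) := by
  have hC := abs_det_le_of_abs_le_mul (of fun i j => S.C (x i) (y j)) (fun i => S.φ (x i))
    (fun i => S.ψ (y i)) fun i j => S.abs_C_le _ _
  have hp := S.abs_det_p_mul_prod_le x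
  have hq := S.swap.abs_det_p_mul_prod_le y
  rw [Fintype.card_fin] at hC
  rw [D_fin, abs_mul]
  calc _ ≤ |(of fun i n => S.p n (x i)).det * (of fun i n => S.q n (y i)).det| *
        |N.factorial * ((∏ i, S.φ (x i)) * ∏ i, S.ψ (y i))| := by
        exact mul_le_mul_of_nonneg_left (hC.trans (le_abs_self _)) (abs_nonneg _)
    _ = N.factorial * (|(of fun i n => S.p n (x i)).det * ∏ i, S.φ (x i)| *
          |(of fun i n => S.q n (y i)).det * ∏ i, S.ψ (y i)|) := by
        simp only [abs_mul, Nat.abs_cast]; ring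
    _ ≤ N.factorial * ((N.factorial * ∏ i, S.majorant (x i)) *
          (N.factorial * ∏ i, S.swap.majorant (y i))) := by
        exact mul_le_mul_of_nonneg_left (mul_le_mul hp hq (abs_nonneg _)
          ((abs_nonneg _).trans hp)) (Nat.cast_nonneg _)
    _ = _ := by ring

omit [SigmaFinite μ] in
theorem measurable_D_fin : Measurable fun z : (Fin N → ℝ) × (Fin N → ℝ) => S.D z.1 z.2 := by
  simp_rw [D_fin]
  refine ((measurable_det _ fun i n => ?_).mul (measurable_det _ fun i n => ?_)).mul
    (measurable_det _ fun i j => ?_)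
  · exact (S.measurable_p n).comp (by fun_prop)
  · exact (S.measurable_q n).comp (by fun_prop)
  · exact S.measurable_C.comp
      (g := Function.uncurry S.C) (f := fun z : (Fin N → ℝ) × (Fin N → ℝ) => (z.1 i, z.2 j))
      (by fun_prop)

/-- Relabelled as a full determinant, the integrand is dominated by a product of majorants in which
the frozen variables contribute only a constant. -/
theorem integrable_D_sumElim {r s k l : ℕ} (x : Fin r → ℝ) (y : Fin s → ℝ) (hk : r + k = N)
    (hl : s + l = N) :
    Integrable (fun z : (Fin k → ℝ) × (Fin l → ℝ) => S.D (Sum.elim x z.1) (Sum.elim y z.2))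
      ((Measure.pi fun _ => μ).prod (Measure.pi fun _ => μ)) := by
  let e : Fin N ≃ Fin r ⊕ Fin k := (finSumFinEquiv.trans (finCongr hk)).symm
  let f : Fin N ≃ Fin s ⊕ Fin l := (finSumFinEquiv.trans (finCongr hl)).symm
  have hD : ∀ z : (Fin k → ℝ) × (Fin l → ℝ), S.D (Sum.elim x z.1) (Sum.elim y z.2) =
      S.D (Sum.elim x z.1 ∘ e) (Sum.elim y z.2 ∘ f) := fun z => (S.D_comp_equiv _ _ e f).symm
  have hm : Measurable fun z : (Fin k → ℝ) × (Fin l → ℝ) =>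
      ((Sum.elim x z.1 ∘ e, Sum.elim y z.2 ∘ f) : (Fin N → ℝ) × (Fin N → ℝ)) := by
    refine Measurable.prodMk (measurable_pi_lambda _ fun i => ?_)
      (measurable_pi_lambda _ fun i => ?_)
    · simp only [Function.comp_apply]
      rcases e i with j | j
      · simp
      · simp only [Sum.elim_inr]; fun_prop
    · simp only [Function.comp_apply]
      rcases f i with j | j
      · simp
      · simp only [Sum.elim_inr]; fun_prop
  simp_rw [hD]
  have hg : Integrable (fun x' : Fin k → ℝ => ∏ i, S.majorant (x' i)) (Measure.pi fun _ => μ) :=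
    Integrable.fintype_prod fun _ => S.integrable_majorant
  have hh : Integrable (fun y' : Fin l → ℝ => ∏ i, S.swap.majorant (y' i))
      (Measure.pi fun _ => μ) := Integrable.fintype_prod fun _ => S.swap.integrable_majorant
  refine ((hg.mul_prod hh).const_mul (N.factorial ^ 3 * ((∏ i, S.majorant (x i)) *
    ∏ i, S.swap.majorant (y i)))).mono' (S.measurable_D_fin.comp hm).aestronglyMeasurable ?_
  refine Filter.Eventually.of_forall fun z => ?_
  refine (S.abs_D_fin_le _ _).trans (le_of_eq ?_)
  have h1 : ∏ i, S.majorant ((Sum.elim x z.1 ∘ e) i) =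
      (∏ i, S.majorant (x i)) * ∏ i, S.majorant (z.1 i) := by
    simp only [Function.comp_apply]
    rw [e.prod_comp (fun i => S.majorant (Sum.elim x z.1 i)), Fintype.prod_sum_type]; rfl
  have h2 : ∏ i, S.swap.majorant ((Sum.elim y z.2 ∘ f) i) =
      (∏ i, S.swap.majorant (y i)) * ∏ i, S.swap.majorant (z.2 i) := by
    simp only [Function.comp_apply]
    rw [f.prod_comp (fun i => S.swap.majorant (Sum.elim y z.2 i)), Fintype.prod_sum_type]; rfl
  rw [h1, h2]
  ring

end BiorthogonalSystem

/-! ### Partial fractions for the Jacobi coefficients -/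

section Jacobi

theorem Gamma_add_natCast {x : ℝ} (hx : 0 < x) (n : ℕ) :
    Real.Gamma (x + n) = (∏ j ∈ Finset.range n, (x + j)) * Real.Gamma x := by
  induction n with
  | zero => simp
  | succ n ih =>
    rw [Finset.prod_range_succ, Nat.cast_succ, ← add_assoc, Real.Gamma_add_one (by positivity), ih]
    ring

theorem jacobiCoeff_eq {α : ℝ} (hα : -1 < α) (n l : ℕ) :
    jacobiCoeff α n l = (-1) ^ l * (∏ j ∈ Finset.range n, (α + l + 1 + j)) /
      ((l.factorial : ℝ) * (n - l).factorial) := by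
  have hpos : 0 < α + l + 1 := by have := Nat.cast_nonneg (α := ℝ) l; linarith
  have hG := (Real.Gamma_pos_of_pos hpos).ne'
  rw [jacobiCoeff, show α + n + l + 1 = α + l + 1 + n by ring, Gamma_add_natCast hpos]
  field_simp

/-- This is the inverse of the Lagrange weight at the node `-(α + 1 + l)`. -/
theorem prod_range_erase_sub {n l : ℕ} (hl : l ≤ n) :
    ∏ j ∈ (Finset.range (n + 1)).erase l, ((j : ℝ) - l) =
      (-1) ^ l * (l.factorial * (n - l).factorial) := by
  have h : (Finset.range (n + 1)).erase l = Finset.range l ∪ Finset.Ico (l + 1) (n + 1) := by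
    ext j; simp only [Finset.mem_erase, Finset.mem_range, Finset.mem_union, Finset.mem_Ico]; omega
  rw [h, Finset.prod_union]
  · rw [← mul_assoc]
    congr 1
    · rw [← Finset.prod_range_reflect, ← Finset.prod_range_add_one_eq_factorial]
      push_cast
      have : (-1 : ℝ) ^ l = ∏ j ∈ Finset.range l, (-1 : ℝ) := by simp
      rw [this, ← Finset.prod_mul_distrib]
      refine Finset.prod_congr rfl fun j hj => ?_
      have := Finset.mem_range.1 hj
      rw [show l - 1 - j = l - (j + 1) by omega, Nat.cast_sub (by omega)]
      push_cast; ring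
    · rw [Finset.prod_Ico_eq_prod_range, ← Finset.prod_range_add_one_eq_factorial]
      push_cast
      refine Finset.prod_congr (by simp) fun j _ => by ring
  · rw [Finset.disjoint_left]
    intro j; simp only [Finset.mem_range, Finset.mem_Ico]; omega

/-- Partial fraction decomposition with the Jacobi coefficients. -/
theorem sum_jacobiCoeff_div {α : ℝ} (hα : -1 < α) (n : ℕ) {s : ℝ} (hs : 0 ≤ s) :
    ∑ l ∈ Finset.range (n + 1), jacobiCoeff α n l / (α + 1 + l + s) =
      (-1) ^ n * (∏ j ∈ Finset.range n, (s - j)) /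
        ∏ l ∈ Finset.range (n + 1), (α + 1 + l + s) := by
  have hpos : ∀ l : ℕ, 0 < α + 1 + l + s := fun l => by
    have := Nat.cast_nonneg (α := ℝ) l; linarith
  -- The polynomial `∏_{j<n} (X - j)` has degree `n`, so it equals its interpolant at the `n + 1`
  -- poles. The barycentric formula at `s` is then the partial fraction expansion, its values at the
  -- nodes giving the numerators of `jacobiCoeff`.
  let v : ℕ → ℝ := fun l => -(α + 1 + l)
  let f : Polynomial ℝ := ∏ j ∈ Finset.range n, (Polynomial.X - Polynomial.C (j : ℝ))
  have hv : Set.InjOn v (Finset.range (n + 1)) := by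
    intro i _ j _ hij
    simp only [v] at hij
    exact_mod_cast (by linarith : (i : ℝ) = j)
  have hdeg : f.degree < (Finset.range (n + 1)).card := by
    have : f.degree = n := by
      simp only [f]
      rw [Polynomial.degree_prod]
      simp only [Polynomial.degree_X_sub_C]
      simp
    rw [this, Finset.card_range]
    exact_mod_cast Nat.lt_succ_self n
  have h := Lagrange.eval_interpolate_not_at_node (s := Finset.range (n + 1)) (v := v) (x := s)
    (fun i => f.eval (v i)) (fun i _ => by simp only [v]; have := hpos i; intro h; linarith)
  rw [← Lagrange.eq_interpolate hv hdeg] at h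
  have hf : f.eval s = ∏ j ∈ Finset.range n, (s - j) := by simp [f, Polynomial.eval_prod]
  have hn : (Lagrange.nodal (Finset.range (n + 1)) v).eval s =
      ∏ l ∈ Finset.range (n + 1), (α + 1 + l + s) := by
    rw [Lagrange.eval_nodal]
    exact Finset.prod_congr rfl fun l _ => by simp only [v]; ring
  have hsgn : ((-1 : ℝ) ^ n) * (-1) ^ n = 1 := by rw [← mul_pow]; simp
  rw [hf, hn] at h
  rw [eq_div_iff (Finset.prod_ne_zero_iff.2 fun l _ => (hpos l).ne'), h, ← mul_assoc, mul_comm,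
    mul_comm ((-1 : ℝ) ^ n), mul_assoc]
  congr 1
  rw [Finset.mul_sum]
  refine Finset.sum_congr rfl fun l hl => ?_
  have hl' : l ≤ n := Nat.lt_succ_iff.1 (Finset.mem_range.1 hl)
  have hw : Lagrange.nodalWeight (Finset.range (n + 1)) v l =
      ((-1) ^ l * (l.factorial * (n - l).factorial : ℝ))⁻¹ := by
    rw [Lagrange.nodalWeight, Finset.prod_inv_distrib, ← prod_range_erase_sub hl']
    congr 1
    exact Finset.prod_congr rfl fun j _ => by simp only [v]; ring
  have hfl : f.eval (v l) = (-1) ^ n * ∏ j ∈ Finset.range n, (α + l + 1 + j) := by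
    have : (-1 : ℝ) ^ n = ∏ j ∈ Finset.range n, (-1 : ℝ) := by simp
    rw [this, ← Finset.prod_mul_distrib]
    simp only [f, Polynomial.eval_prod, Polynomial.eval_sub, Polynomial.eval_X, Polynomial.eval_C]
    exact Finset.prod_congr rfl fun j _ => by simp only [v]; ring
  have hinv : (s - v l)⁻¹ = (α + 1 + l + s)⁻¹ := by simp only [v]; congr 1; ring
  have hl2 : ((-1 : ℝ) ^ l)⁻¹ = (-1) ^ l := by
    rw [← inv_pow]; norm_num
  rw [hw, hfl, hinv, jacobiCoeff_eq hα, mul_inv, hl2, div_eq_mul_inv, div_eq_mul_inv]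
  linear_combination -((-1) ^ l * (∏ j ∈ Finset.range n, (α + l + 1 + j)) *
    ((l.factorial : ℝ) * (n - l).factorial)⁻¹ * (α + 1 + l + s)⁻¹) * hsgn

/-- The inner sum at `s = k` contains `∏_{j<n} (k - j)`, which vanishes for `k < n`. Since `k ≤ m ≤
n`, only `k = m = n` can survive. -/
theorem sum_jacobiCoeff_mul_of_le {α : ℝ} (hα : -1 < α) {n m : ℕ} (hmn : m ≤ n) :
    ∑ k ∈ Finset.range (m + 1), ∑ l ∈ Finset.range (n + 1),
      jacobiCoeff α n l * jacobiCoeff α m k / (α + 1 + l + k) =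
      if n = m then 1 / (2 * n + α + 1) else 0 := by
  have h1 : ∀ k : ℕ, ∑ l ∈ Finset.range (n + 1),
      jacobiCoeff α n l * jacobiCoeff α m k / (α + 1 + l + k) = jacobiCoeff α m k *
      ((-1) ^ n * (∏ j ∈ Finset.range n, ((k : ℝ) - j)) /
        ∏ l ∈ Finset.range (n + 1), (α + 1 + l + k)) := by
    intro k
    rw [← sum_jacobiCoeff_div hα n (Nat.cast_nonneg k), Finset.mul_sum]
    exact Finset.sum_congr rfl fun l _ => by ring
  have h0 : ∀ k < n, ∏ j ∈ Finset.range n, ((k : ℝ) - j) = 0 := fun k hk =>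
    Finset.prod_eq_zero (Finset.mem_range.2 hk) (sub_self _)
  simp_rw [h1]
  split_ifs with h
  · subst h
    rw [Finset.sum_range_succ, Finset.sum_eq_zero, zero_add, jacobiCoeff_eq hα,
      Finset.prod_range_succ]
    · have e1 : ∏ j ∈ Finset.range n, ((n : ℝ) - j) = n.factorial := by
        rw [← Finset.prod_range_reflect, ← Finset.prod_range_add_one_eq_factorial]
        push_cast
        refine Finset.prod_congr rfl fun j hj => ?_
        have := Finset.mem_range.1 hj
        rw [show n - 1 - j = n - (j + 1) by omega, Nat.cast_sub (by omega)]
        push_cast; ring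
      have e2 : ∏ l ∈ Finset.range n, (α + 1 + l + n) =
          ∏ j ∈ Finset.range n, (α + n + 1 + j) :=
        Finset.prod_congr rfl fun j _ => by ring
      have hsgn : ((-1 : ℝ) ^ n) * (-1) ^ n = 1 := by rw [← mul_pow]; simp
      have hne : ∏ j ∈ Finset.range n, (α + n + 1 + j) ≠ 0 := by
        refine Finset.prod_ne_zero_iff.2 fun j _ => ?_
        have := Nat.cast_nonneg (α := ℝ) n
        have := Nat.cast_nonneg (α := ℝ) j
        linarith
      have hne2 : α + 1 + n + n ≠ 0 := by
        have := Nat.cast_nonneg (α := ℝ) n; linarith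
      have hne3 : 2 * n + α + 1 ≠ 0 := by
        have := Nat.cast_nonneg (α := ℝ) n; linarith
      have hfac : (n.factorial : ℝ) ≠ 0 := by positivity
      rw [e1, e2]
      simp only [Nat.sub_self, Nat.factorial_zero, Nat.cast_one, mul_one]
      rw [show α + 1 + (n : ℝ) + n = 2 * n + α + 1 by ring, div_mul_div_comm,
        div_eq_div_iff (by positivity) hne3]
      linear_combination ((∏ j ∈ Finset.range n, (α + n + 1 + j)) * n.factorial *
        (2 * n + α + 1)) * hsgn
    · intro k hk
      rw [h0 k (Finset.mem_range.1 hk)]; simp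
  · refine Finset.sum_eq_zero fun k hk => ?_
    have := Finset.mem_range.1 hk
    rw [h0 k (by omega)]; simp

theorem sum_jacobiCoeff_mul {α : ℝ} (hα : -1 < α) (n m : ℕ) :
    ∑ l ∈ Finset.range (n + 1), ∑ k ∈ Finset.range (m + 1),
      jacobiCoeff α n l * jacobiCoeff α m k / (α + 1 + l + k) =
      if n = m then 1 / (2 * n + α + 1) else 0 := by
  rcases le_total m n with h | h
  · rw [Finset.sum_comm]; exact sum_jacobiCoeff_mul_of_le hα h
  · have := sum_jacobiCoeff_mul_of_le hα h
    simp_rw [mul_comm (jacobiCoeff α m _), add_right_comm (α + 1)] at this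
    rw [this]
    by_cases hnm : n = m
    · simp [hnm]
    · simp [hnm, Ne.symm hnm]

end Jacobi

/-! ### Moments of the Cauchy–Laguerre weight -/

section CauchyIntegral

open Real Set

/-- With `u = x + y` this replaces the Cauchy kernel by an integral of products of a function of `x`
and a function of `y`. -/
theorem lintegral_exp_neg_mul_Ioi_one {u : ℝ} (hu : 0 < u) :
    ∫⁻ t in Ioi (1 : ℝ), ENNReal.ofReal (exp (-(t * u))) = ENNReal.ofReal (exp (-u) / u) := by
  have h := integral_exp_mul_Ioi (a := -u) (by linarith) 1
  have hi := integrableOn_exp_mul_Ioi (a := -u) (by linarith) 1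
  simp only [neg_mul, mul_one] at h hi
  simp_rw [mul_comm _ u]
  rw [← ofReal_integral_eq_lintegral_ofReal hi
    (Filter.Eventually.of_forall fun t => (exp_pos _).le), h]
  congr 1
  rw [neg_div_neg_eq]

theorem integrableOn_rpow_mul_exp_neg_mul {A t : ℝ} (hA : -1 < A) (ht : 0 < t) :
    IntegrableOn (fun x => x ^ A * exp (-(t * x))) (Ioi 0) := by
  have := integrableOn_rpow_mul_exp_neg_mul_rpow hA one_pos ht
  simpa using this

theorem lintegral_rpow_mul_exp_neg_mul_Ioi {A t : ℝ} (hA : -1 < A) (ht : 0 < t) :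
    ∫⁻ x in Ioi (0 : ℝ), ENNReal.ofReal (x ^ A * exp (-(t * x))) =
      ENNReal.ofReal (Gamma (A + 1) * t ^ (-(A + 1))) := by
  have h := integral_rpow_mul_exp_neg_mul_Ioi (a := A + 1) (by linarith) ht
  rw [← ofReal_integral_eq_lintegral_ofReal (integrableOn_rpow_mul_exp_neg_mul hA ht)]
  · simp only [add_sub_cancel_right] at h
    rw [h, mul_comm, one_div, inv_rpow ht.le, rpow_neg ht.le]
  · filter_upwards [ae_restrict_mem measurableSet_Ioi] with x hx
    have : 0 < x := hx
    positivity

/-- Tonelli leaves two Gamma integrals for each `t`, hence `t ^ (-(A + B + 2))`, integrable on `(1,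
∞)` because `A + B > -1`. -/
theorem lintegral_cauchy_laguerre {A B : ℝ} (hA : -1 < A) (hB : -1 < B) (hAB : -1 < A + B) :
    ∫⁻ z in Ioi (0 : ℝ) ×ˢ Ioi (0 : ℝ),
      ENNReal.ofReal (exp (-(z.1 + z.2)) / (z.1 + z.2) * z.1 ^ A * z.2 ^ B) =
      ENNReal.ofReal (Gamma (A + 1) * Gamma (B + 1) / (A + B + 1)) := by
  have hm : MeasurableSet (Ioi (0 : ℝ) ×ˢ Ioi (0 : ℝ)) := measurableSet_Ioi.prod measurableSet_Ioi
  have h1 : ∀ z ∈ Ioi (0 : ℝ) ×ˢ Ioi (0 : ℝ),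
      ENNReal.ofReal (exp (-(z.1 + z.2)) / (z.1 + z.2) * z.1 ^ A * z.2 ^ B) =
      ∫⁻ t in Ioi (1 : ℝ), ENNReal.ofReal (z.1 ^ A * exp (-(t * z.1))) *
        ENNReal.ofReal (z.2 ^ B * exp (-(t * z.2))) := by
    rintro ⟨x, y⟩ ⟨hx, hy⟩
    simp only [mem_Ioi] at hx hy
    simp only
    have : 0 < x ^ A := rpow_pos_of_pos hx _
    have : 0 < y ^ B := rpow_pos_of_pos hy _
    rw [show exp (-(x + y)) / (x + y) * x ^ A * y ^ B =
      (x ^ A * y ^ B) * (exp (-(x + y)) / (x + y)) by ring, ENNReal.ofReal_mul (by positivity),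
      ← lintegral_exp_neg_mul_Ioi_one (add_pos hx hy), ← lintegral_const_mul _ (by fun_prop)]
    refine lintegral_congr fun t => ?_
    rw [← ENNReal.ofReal_mul (by positivity), ← ENNReal.ofReal_mul (by positivity)]
    congr 1
    rw [show -(t * (x + y)) = -(t * x) + -(t * y) by ring, exp_add]
    ring
  rw [setLIntegral_congr_fun hm h1, lintegral_lintegral_swap (by
    refine Measurable.aemeasurable ?_
    simp only [Function.uncurry_def]
    fun_prop)]
  have h2 : ∀ t ∈ Ioi (1 : ℝ), (∫⁻ z in Ioi (0 : ℝ) ×ˢ Ioi (0 : ℝ),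
      ENNReal.ofReal (z.1 ^ A * exp (-(t * z.1))) *
        ENNReal.ofReal (z.2 ^ B * exp (-(t * z.2)))) =
      ENNReal.ofReal (Gamma (A + 1) * Gamma (B + 1)) * ENNReal.ofReal (t ^ (-(A + B + 2))) := by
    intro t ht
    have ht0 : 0 < t := lt_trans one_pos ht
    rw [Measure.volume_eq_prod, ← Measure.prod_restrict,
      lintegral_prod_mul (f := fun x => ENNReal.ofReal (x ^ A * exp (-(t * x))))
        (g := fun y => ENNReal.ofReal (y ^ B * exp (-(t * y)))) (by fun_prop) (by fun_prop),
      lintegral_rpow_mul_exp_neg_mul_Ioi hA ht0, lintegral_rpow_mul_exp_neg_mul_Ioi hB ht0]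
    have hgA := Gamma_pos_of_pos (s := A + 1) (by linarith)
    have hgB := Gamma_pos_of_pos (s := B + 1) (by linarith)
    rw [← ENNReal.ofReal_mul (by positivity), ← ENNReal.ofReal_mul (by positivity)]
    congr 1
    rw [show -(A + B + 2) = -(A + 1) + -(B + 1) by ring, rpow_add ht0]
    ring
  have hgA := Gamma_pos_of_pos (s := A + 1) (by linarith)
  have hgB := Gamma_pos_of_pos (s := B + 1) (by linarith)
  rw [setLIntegral_congr_fun measurableSet_Ioi h2, lintegral_const_mul _ (by fun_prop),
    ← ofReal_integral_eq_lintegral_ofReal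
      (integrableOn_Ioi_rpow_of_lt (by linarith) one_pos), integral_Ioi_rpow_of_lt (by linarith)
      one_pos, ← ENNReal.ofReal_mul (by positivity)]
  · congr 1
    rw [one_rpow, show -(A + B + 2) + 1 = -(A + B + 1) by ring, neg_div_neg_eq, mul_one_div]
  · filter_upwards [ae_restrict_mem measurableSet_Ioi] with x hx
    have : 0 < x := lt_trans one_pos hx
    positivity

theorem cauchy_laguerre_nonneg (A B : ℝ) : ∀ z ∈ Ioi (0 : ℝ) ×ˢ Ioi (0 : ℝ),
    0 ≤ exp (-(z.1 + z.2)) / (z.1 + z.2) * z.1 ^ A * z.2 ^ B := by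
  rintro ⟨x, y⟩ ⟨hx, hy⟩
  simp only [mem_Ioi] at hx hy
  positivity

theorem integrableOn_cauchy_laguerre {A B : ℝ} (hA : -1 < A) (hB : -1 < B) (hAB : -1 < A + B) :
    IntegrableOn (fun z : ℝ × ℝ => exp (-(z.1 + z.2)) / (z.1 + z.2) * z.1 ^ A * z.2 ^ B)
      (Ioi (0 : ℝ) ×ˢ Ioi (0 : ℝ)) := by
  have hm : MeasurableSet (Ioi (0 : ℝ) ×ˢ Ioi (0 : ℝ)) := measurableSet_Ioi.prod measurableSet_Ioi
  refine (lintegral_ofReal_ne_top_iff_integrable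
    (Measurable.aestronglyMeasurable (by fun_prop)) ?_).1 ?_
  · filter_upwards [ae_restrict_mem hm] with z hz using cauchy_laguerre_nonneg A B z hz
  · rw [lintegral_cauchy_laguerre hA hB hAB]; exact ENNReal.ofReal_ne_top

theorem integral_cauchy_laguerre {A B : ℝ} (hA : -1 < A) (hB : -1 < B) (hAB : -1 < A + B) :
    ∫ z in Ioi (0 : ℝ) ×ˢ Ioi (0 : ℝ), exp (-(z.1 + z.2)) / (z.1 + z.2) * z.1 ^ A * z.2 ^ B =
      Gamma (A + 1) * Gamma (B + 1) / (A + B + 1) := by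
  have hm : MeasurableSet (Ioi (0 : ℝ) ×ˢ Ioi (0 : ℝ)) := measurableSet_Ioi.prod measurableSet_Ioi
  have hgA := Gamma_pos_of_pos (s := A + 1) (by linarith)
  have hgB := Gamma_pos_of_pos (s := B + 1) (by linarith)
  have hAB' : 0 < A + B + 1 := by linarith
  rw [integral_eq_lintegral_of_nonneg_ae, lintegral_cauchy_laguerre hA hB hAB,
    ENNReal.toReal_ofReal (by positivity)]
  · filter_upwards [ae_restrict_mem hm] with z hz using cauchy_laguerre_nonneg A B z hz
  · exact Measurable.aestronglyMeasurable (by fun_prop)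

end CauchyIntegral

/-! ### Bi-orthogonality of the explicit polynomials -/

section Biorthogonality

open Polynomial

theorem jacobiCoeff_self_ne_zero {α : ℝ} (hα : -1 < α) (n : ℕ) : jacobiCoeff α n n ≠ 0 := by
  rw [jacobiCoeff_eq hα]
  have : ∏ j ∈ Finset.range n, (α + n + 1 + j) ≠ 0 := by
    refine Finset.prod_ne_zero_iff.2 fun j _ => ?_
    have := Nat.cast_nonneg (α := ℝ) n
    have := Nat.cast_nonneg (α := ℝ) j
    linarith
  positivity

theorem natDegree_sum_monomial {n : ℕ} (c : ℕ → ℝ) (hc : c n ≠ 0) :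
    (∑ l ∈ Finset.range (n + 1), monomial l (c l)).natDegree = n := by
  refine natDegree_eq_of_le_of_coeff_ne_zero ?_ ?_
  · refine natDegree_sum_le_of_forall_le _ _ fun l hl => ?_
    exact (natDegree_monomial_le _).trans (Nat.lt_succ_iff.1 (Finset.mem_range.1 hl))
  · simpa [finsetSum_coeff, coeff_monomial] using hc

/-- The Gamma functions in the coefficients cancel those of the moments. What remains has
denominators `a + b + 1 + θ(l + k) = θ(α + 1 + l + k)`, so the Jacobi sum appears divided by `θ`. -/
theorem isCauchyBiorthogonal_PHat_QHat {a b θ : ℝ} (ha : -1 < a) (hb : -1 < b) (hab : -1 < a + b)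
    (hθ : 0 < θ) : IsCauchyBiorthogonal a b θ (PHat a b θ) (QHat a b θ) := by
  have hα : -1 < alphaParam a b θ := by
    have : 0 < (a + b + 1) / θ := div_pos (by linarith) hθ
    unfold alphaParam; linarith
  have hGa : ∀ l : ℕ, Real.Gamma (a + θ * l + 1) ≠ 0 := fun l =>
    (Real.Gamma_pos_of_pos (by have : 0 ≤ θ * l := by positivity
                               linarith)).ne'
  have hGb : ∀ l : ℕ, Real.Gamma (b + θ * l + 1) ≠ 0 := fun l =>
    (Real.Gamma_pos_of_pos (by have : 0 ≤ θ * l := by positivity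
                               linarith)).ne'
  refine ⟨fun n => ⟨?_, ?_⟩, fun n m => ?_⟩
  · exact natDegree_sum_monomial _ (div_ne_zero (jacobiCoeff_self_ne_zero hα n) (hGa n))
  · exact natDegree_sum_monomial _ (div_ne_zero (jacobiCoeff_self_ne_zero hα n) (hGb n))
  have hA : ∀ l : ℕ, -1 < a + θ * l := fun l => by
    have : 0 ≤ θ * l := by positivity
    linarith
  have hB : ∀ l : ℕ, -1 < b + θ * l := fun l => by
    have : 0 ≤ θ * l := by positivity
    linarith
  have hAB : ∀ l k : ℕ, -1 < a + θ * l + (b + θ * k) := fun l k => by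
    have : 0 ≤ θ * l := by positivity
    have : 0 ≤ θ * k := by positivity
    linarith
  have hm : MeasurableSet (Set.Ioi (0 : ℝ) ×ˢ Set.Ioi (0 : ℝ)) :=
    measurableSet_Ioi.prod measurableSet_Ioi
  set α := alphaParam a b θ with hαdef
  let c : ℕ → ℕ → ℝ := fun l k => jacobiCoeff α n l / Real.Gamma (a + θ * l + 1) *
    (jacobiCoeff α m k / Real.Gamma (b + θ * k + 1))
  have h1 : ∀ z ∈ Set.Ioi (0 : ℝ) ×ˢ Set.Ioi (0 : ℝ),
      Real.exp (-(z.1 + z.2)) / (z.1 + z.2) * z.1 ^ a * z.2 ^ b *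
          (PHat a b θ n).eval (z.1 ^ θ) * (QHat a b θ m).eval (z.2 ^ θ) =
      ∑ l ∈ Finset.range (n + 1), ∑ k ∈ Finset.range (m + 1), c l k *
        (Real.exp (-(z.1 + z.2)) / (z.1 + z.2) * z.1 ^ (a + θ * l) * z.2 ^ (b + θ * k)) := by
    rintro ⟨x, y⟩ ⟨hx, hy⟩
    simp only [Set.mem_Ioi] at hx hy
    simp only [PHat, QHat, eval_finsetSum, eval_monomial, Finset.mul_sum, Finset.sum_mul]
    rw [Finset.sum_comm]
    refine Finset.sum_congr rfl fun l _ => Finset.sum_congr rfl fun k _ => ?_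
    rw [Real.rpow_add hx, Real.rpow_add hy, Real.rpow_mul hx.le, Real.rpow_mul hy.le,
      Real.rpow_natCast, Real.rpow_natCast]
    simp only [c, ← hαdef]
    ring
  have hi : ∀ l k : ℕ, IntegrableOn (fun z : ℝ × ℝ => c l k *
      (Real.exp (-(z.1 + z.2)) / (z.1 + z.2) * z.1 ^ (a + θ * l) * z.2 ^ (b + θ * k)))
      (Set.Ioi (0 : ℝ) ×ˢ Set.Ioi (0 : ℝ)) := fun l k =>
    (integrableOn_cauchy_laguerre (hA l) (hB k) (hAB l k)).const_mul _
  rw [setIntegral_congr_fun hm h1, integral_finsetSum _ fun l _ =>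
    integrable_finsetSum _ fun k _ => hi l k]
  simp_rw [integral_finsetSum _ fun k _ => hi _ k, integral_const_mul,
    integral_cauchy_laguerre (hA _) (hB _) (hAB _ _)]
  have h2 := congrArg (fun t => t / θ) (sum_jacobiCoeff_mul hα n m)
  have hαθ : θ * (α + 1) = a + b + 1 := by
    rw [hαdef, alphaParam]; field_simp; ring
  simp only [Finset.sum_div] at h2
  convert h2 using 1
  · refine Finset.sum_congr rfl fun l _ => Finset.sum_congr rfl fun k _ => ?_
    rw [show a + θ * l + (b + θ * k) + 1 = θ * (α + 1 + l + k) by linear_combination -hαθ]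
    simp only [c]
    have := hGa l
    have := hGb k
    have h0 : α + 1 + (l : ℝ) + k ≠ 0 := by
      have := Nat.cast_nonneg (α := ℝ) l
      have := Nat.cast_nonneg (α := ℝ) k
      linarith
    field_simp
  · split_ifs
    · have h0 : 2 * (n : ℝ) + α + 1 ≠ 0 := by
        have := Nat.cast_nonneg (α := ℝ) n; linarith
      rw [hNorm, show 2 * n * θ + a + b + 1 = θ * (2 * n + α + 1) by linear_combination -hαθ]
      field_simp
    · simp

end Biorthogonality

/-! ### Factorial moment measures -/

/-- An embedding of `Fin r` into `Fin (r + k)` extends to an equivalence of `Fin r ⊕ Fin k`. -/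
theorem exists_sum_equiv_extending {r k N : ℕ} (h : r + k = N) (σ : Fin r ↪ Fin N) :
    ∃ e : Fin r ⊕ Fin k ≃ Fin N, ∀ i, e (Sum.inl i) = σ i := by
  have hcard : Fintype.card (Fin k) = Fintype.card ((Set.range σ)ᶜ : Set (Fin N)) := by
    rw [Fintype.card_compl_set, Set.card_range_of_injective σ.injective]
    simp; omega
  let f : Fin k ≃ ((Set.range σ)ᶜ : Set (Fin N)) := Fintype.equivOfCardEq hcard
  exact ⟨((Equiv.ofInjective σ σ.injective).sumCongr f).trans (Equiv.Set.sumCompl (Set.range σ)),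
    fun i => by simp⟩

/-- The vector whose entries, relabelled by `e`, are those of two given vectors. -/
def glue {r k N : ℕ} (e : Fin r ⊕ Fin k ≃ Fin N) (z : (Fin r → ℝ) × (Fin k → ℝ)) : Fin N → ℝ :=
  Sum.elim z.1 z.2 ∘ e.symm

/-- Splitting the coordinates along an equivalence preserves product measures. -/
theorem measurePreserving_glue {r k N : ℕ} (μ : Measure ℝ) [SigmaFinite μ]
    (e : Fin r ⊕ Fin k ≃ Fin N) :
    MeasurePreserving (glue e) ((Measure.pi fun _ => μ).prod (Measure.pi fun _ => μ))
      (Measure.pi fun _ => μ) := by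
  have h1 := measurePreserving_sumPiEquivProdPi_symm (ι := Fin r) (ι' := Fin k)
    (X := fun _ => ℝ) (fun _ => μ)
  have h2 := measurePreserving_piCongrLeft (fun _ : Fin N => μ) e
  convert h2.comp h1 using 1
  ext z i
  obtain ⟨j, rfl⟩ := e.surjective i
  simp only [glue, Function.comp_apply, MeasurableEquiv.coe_piCongrLeft, Equiv.piCongrLeft_apply_apply,
    MeasurableEquiv.coe_sumPiEquivProdPi_symm, Equiv.symm_apply_apply]
  rcases j with j | j <;> rfl

namespace BiorthogonalSystem

variable {μ : Measure ℝ} [SigmaFinite μ] {N : ℕ} (S : BiorthogonalSystem μ N)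

omit [SigmaFinite μ] in
theorem measurable_D_sumElim {r s k l : ℕ} (hk : r + k = N) (hl : s + l = N) :
    Measurable fun z : ((Fin r → ℝ) × (Fin k → ℝ)) × ((Fin s → ℝ) × (Fin l → ℝ)) =>
      S.D (Sum.elim z.1.1 z.1.2) (Sum.elim z.2.1 z.2.2) := by
  let e : Fin N ≃ Fin r ⊕ Fin k := (finSumFinEquiv.trans (finCongr hk)).symm
  let f : Fin N ≃ Fin s ⊕ Fin l := (finSumFinEquiv.trans (finCongr hl)).symm
  have hD : ∀ z : ((Fin r → ℝ) × (Fin k → ℝ)) × ((Fin s → ℝ) × (Fin l → ℝ)),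
      S.D (Sum.elim z.1.1 z.1.2) (Sum.elim z.2.1 z.2.2) =
      S.D (Sum.elim z.1.1 z.1.2 ∘ e) (Sum.elim z.2.1 z.2.2 ∘ f) :=
    fun z => (S.D_comp_equiv _ _ e f).symm
  simp_rw [hD]
  refine S.measurable_D_fin.comp (f := fun z : ((Fin r → ℝ) × (Fin k → ℝ)) ×
    ((Fin s → ℝ) × (Fin l → ℝ)) => (Sum.elim z.1.1 z.1.2 ∘ e, Sum.elim z.2.1 z.2.2 ∘ f)) ?_
  refine Measurable.prodMk (measurable_pi_lambda _ fun i => ?_)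
    (measurable_pi_lambda _ fun i => ?_)
  · simp only [Function.comp_apply]
    rcases e i with j | j <;> simp only [Sum.elim_inl, Sum.elim_inr] <;> fun_prop
  · simp only [Function.comp_apply]
    rcases f i with j | j <;> simp only [Sum.elim_inl, Sum.elim_inr] <;> fun_prop

omit [SigmaFinite μ] in
theorem D_sumElim_nonneg (hnn : ∀ x y : Fin N → ℝ, 0 ≤ S.D x y) {r s k l : ℕ} (hk : r + k = N)
    (hl : s + l = N) (x : Fin r → ℝ) (x' : Fin k → ℝ) (y : Fin s → ℝ) (y' : Fin l → ℝ) :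
    0 ≤ S.D (Sum.elim x x') (Sum.elim y y') := by
  rw [← S.D_comp_equiv _ _ (finSumFinEquiv.trans (finCongr hk)).symm
    (finSumFinEquiv.trans (finCongr hl)).symm]
  exact hnn _ _

theorem lintegral_D_sumElim (hnn : ∀ x y : Fin N → ℝ, 0 ≤ S.D x y) {r s k l : ℕ}
    (hk : r + k = N) (hl : s + l = N) (x : Fin r → ℝ) (y : Fin s → ℝ) :
    ∫⁻ x' : Fin k → ℝ, ∫⁻ y' : Fin l → ℝ, ENNReal.ofReal (S.D (Sum.elim x x') (Sum.elim y y'))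
      ∂(Measure.pi fun _ => μ) ∂(Measure.pi fun _ => μ) =
      ENNReal.ofReal (k.factorial * l.factorial * S.D x y) := by
  have hi := S.integrable_D_sumElim x y hk hl
  rw [← S.integral_prod_D_sumElim x y (by simpa using hk) (by simpa using hl) hi,
    ofReal_integral_eq_lintegral_ofReal hi
      (Filter.Eventually.of_forall fun z => S.D_sumElim_nonneg hnn hk hl _ _ _ _),
    lintegral_prod _ hi.aestronglyMeasurable.aemeasurable.ennreal_ofReal]

/-- The contribution of a single choice of particles to the factorial moment measure. -/
theorem lintegral_D_mul_comp_embedding (hnn : ∀ x y : Fin N → ℝ, 0 ≤ S.D x y) {r s k l : ℕ}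
    (hk : r + k = N) (hl : s + l = N) (f : (Fin r → ℝ) × (Fin s → ℝ) → ENNReal)
    (hf : Measurable f) (σ : Fin r ↪ Fin N) (τ : Fin s ↪ Fin N) :
    ∫⁻ z : (Fin N → ℝ) × (Fin N → ℝ), ENNReal.ofReal (S.D z.1 z.2) * f (z.1 ∘ σ, z.2 ∘ τ)
      ∂((Measure.pi fun _ => μ).prod (Measure.pi fun _ => μ)) =
    ENNReal.ofReal (k.factorial * l.factorial) *
      ∫⁻ w, f w * ENNReal.ofReal (S.D w.1 w.2)
        ∂((Measure.pi fun _ => μ).prod (Measure.pi fun _ => μ)) := by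
  obtain ⟨e, he⟩ := exists_sum_equiv_extending hk σ
  obtain ⟨e', he'⟩ := exists_sum_equiv_extending hl τ
  have hmp := (measurePreserving_glue μ e).prod (measurePreserving_glue μ e')
  have hcomp : ∀ (n : ℕ) (i : Fin n ↪ Fin N), Measurable fun x : Fin N → ℝ => x ∘ i :=
    fun n i => measurable_pi_lambda _ fun j => measurable_pi_apply _
  have hmeas : Measurable fun z : (Fin N → ℝ) × (Fin N → ℝ) =>
      ENNReal.ofReal (S.D z.1 z.2) * f (z.1 ∘ σ, z.2 ∘ τ) :=
    S.measurable_D_fin.ennreal_ofReal.mul (hf.comp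
      (((hcomp r σ).comp measurable_fst).prodMk ((hcomp s τ).comp measurable_snd)))
  rw [← hmp.lintegral_comp hmeas]
  -- In the glued coordinates the selected particles are the first blocks, and invariance of `D`
  -- under relabelling removes all dependence on `σ` and `τ`.
  have h1 : ∀ z : ((Fin r → ℝ) × (Fin k → ℝ)) × ((Fin s → ℝ) × (Fin l → ℝ)),
      ENNReal.ofReal (S.D (Prod.map (glue e) (glue e') z).1 (Prod.map (glue e) (glue e') z).2) *
        f ((Prod.map (glue e) (glue e') z).1 ∘ σ, (Prod.map (glue e) (glue e') z).2 ∘ τ) =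
      f (z.1.1, z.2.1) * ENNReal.ofReal (S.D (Sum.elim z.1.1 z.1.2) (Sum.elim z.2.1 z.2.2)) := by
    rintro ⟨⟨x, x'⟩, ⟨y, y'⟩⟩
    simp only [Prod.map_apply, glue]
    rw [S.D_comp_equiv, mul_comm]
    congr 3
    · ext i; simp [← he]
    · ext i; simp [← he']
  rw [lintegral_congr h1]
  have hg : Measurable fun z : ((Fin r → ℝ) × (Fin k → ℝ)) × ((Fin s → ℝ) × (Fin l → ℝ)) =>
      f (z.1.1, z.2.1) * ENNReal.ofReal (S.D (Sum.elim z.1.1 z.1.2) (Sum.elim z.2.1 z.2.2)) :=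
    (hf.comp (by fun_prop)).mul (S.measurable_D_sumElim hk hl).ennreal_ofReal
  rw [lintegral_prod _ hg.aemeasurable, lintegral_prod _ hg.lintegral_prod_right'.aemeasurable]
  have hF : ∀ w : (Fin r → ℝ) × (Fin s → ℝ),
      ENNReal.ofReal (k.factorial * l.factorial) * (f w * ENNReal.ofReal (S.D w.1 w.2)) =
      ∫⁻ x' : Fin k → ℝ, ∫⁻ y' : Fin l → ℝ,
        f w * ENNReal.ofReal (S.D (Sum.elim w.1 x') (Sum.elim w.2 y'))
        ∂(Measure.pi fun _ => μ) ∂(Measure.pi fun _ => μ) := by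
    intro w
    have hm : Measurable fun z : (Fin k → ℝ) × (Fin l → ℝ) =>
        ENNReal.ofReal (S.D (Sum.elim w.1 z.1) (Sum.elim w.2 z.2)) :=
      ((S.measurable_D_sumElim hk hl).comp (f := fun z : (Fin k → ℝ) × (Fin l → ℝ) =>
        ((w.1, z.1), (w.2, z.2))) (by fun_prop)).ennreal_ofReal
    have h2 : ∀ x' : Fin k → ℝ, ∫⁻ y' : Fin l → ℝ,
        f w * ENNReal.ofReal (S.D (Sum.elim w.1 x') (Sum.elim w.2 y')) ∂(Measure.pi fun _ => μ) =
        f w * ∫⁻ y' : Fin l → ℝ, ENNReal.ofReal (S.D (Sum.elim w.1 x') (Sum.elim w.2 y'))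
          ∂(Measure.pi fun _ => μ) := fun x' =>
      lintegral_const_mul _ (hm.comp (f := fun y' => (x', y')) (by fun_prop))
    rw [lintegral_congr h2, lintegral_const_mul _ hm.lintegral_prod_right',
      S.lintegral_D_sumElim hnn hk hl,
      ENNReal.ofReal_mul (p := k.factorial * l.factorial) (by positivity)]
    ring
  rw [← lintegral_const_mul' _ _ ENNReal.ofReal_ne_top, lintegral_congr hF]
  -- The rest is Tonelli: the iterated integrals over `x, x', y, y'` are reordered as `x, y, x',
  -- y'`.
  have hG : Measurable fun u : (((Fin r → ℝ) × (Fin s → ℝ)) × (Fin k → ℝ)) × (Fin l → ℝ) =>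
      f u.1.1 * ENNReal.ofReal (S.D (Sum.elim u.1.1.1 u.1.2) (Sum.elim u.1.1.2 u.2)) :=
    hg.comp (f := fun u : (((Fin r → ℝ) × (Fin s → ℝ)) × (Fin k → ℝ)) × (Fin l → ℝ) =>
      ((u.1.1.1, u.1.2), (u.1.1.2, u.2))) (by fun_prop)
  rw [lintegral_prod _ hG.lintegral_prod_right'.lintegral_prod_right'.aemeasurable]
  refine lintegral_congr fun x => ?_
  have h3 : ∀ x' : Fin k → ℝ, ∫⁻ v : (Fin s → ℝ) × (Fin l → ℝ),
      f (x, v.1) * ENNReal.ofReal (S.D (Sum.elim x x') (Sum.elim v.1 v.2))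
        ∂((Measure.pi fun _ => μ).prod (Measure.pi fun _ => μ)) =
      ∫⁻ y : Fin s → ℝ, ∫⁻ y' : Fin l → ℝ,
        f (x, y) * ENNReal.ofReal (S.D (Sum.elim x x') (Sum.elim y y'))
        ∂(Measure.pi fun _ => μ) ∂(Measure.pi fun _ => μ) := fun x' =>
    lintegral_prod _ (hg.comp (f := fun v : (Fin s → ℝ) × (Fin l → ℝ) => ((x, x'), v))
      (by fun_prop)).aemeasurable
  rw [lintegral_congr h3]
  refine lintegral_lintegral_swap (Measurable.aemeasurable ?_)
  exact (hG.comp (f := fun u : ((Fin k → ℝ) × (Fin s → ℝ)) × (Fin l → ℝ) =>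
    (((x, u.1.2), u.1.1), u.2)) (by fun_prop)).lintegral_prod_right'

/-- The determinants of kernels are the densities of the factorial moment measures. -/
theorem lintegral_sum_embedding (hnn : ∀ x y : Fin N → ℝ, 0 ≤ S.D x y) {r s : ℕ}
    (hr : r ≤ N) (hs : s ≤ N) (f : (Fin r → ℝ) × (Fin s → ℝ) → ENNReal) (hf : Measurable f) :
    ∫⁻ z : (Fin N → ℝ) × (Fin N → ℝ),
      ∑ σ : Fin r ↪ Fin N, ∑ τ : Fin s ↪ Fin N, f (z.1 ∘ σ, z.2 ∘ τ)
      ∂((Measure.pi fun _ => μ).prod (Measure.pi fun _ => μ)).withDensity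
        (fun z => ENNReal.ofReal (S.D z.1 z.2 / (N.factorial : ℝ) ^ 2)) =
    ∫⁻ w, f w * ENNReal.ofReal (S.D w.1 w.2)
      ∂((Measure.pi fun _ => μ).prod (Measure.pi fun _ => μ)) := by
  have hcomp : ∀ (n : ℕ) (i : Fin n ↪ Fin N), Measurable fun x : Fin N → ℝ => x ∘ i :=
    fun n i => measurable_pi_lambda _ fun j => measurable_pi_apply _
  have hfm : ∀ (σ : Fin r ↪ Fin N) (τ : Fin s ↪ Fin N),
      Measurable fun z : (Fin N → ℝ) × (Fin N → ℝ) => f (z.1 ∘ σ, z.2 ∘ τ) := fun σ τ =>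
    hf.comp (((hcomp r σ).comp measurable_fst).prodMk ((hcomp s τ).comp measurable_snd))
  have hN : (0 : ℝ) < (N.factorial : ℝ) ^ 2 := by positivity
  have hDm : Measurable fun z : (Fin N → ℝ) × (Fin N → ℝ) => ENNReal.ofReal (S.D z.1 z.2) :=
    S.measurable_D_fin.ennreal_ofReal
  have hd : ∀ z : (Fin N → ℝ) × (Fin N → ℝ),
      ENNReal.ofReal (S.D z.1 z.2 / (N.factorial : ℝ) ^ 2) =
        ENNReal.ofReal (((N.factorial : ℝ) ^ 2)⁻¹) * ENNReal.ofReal (S.D z.1 z.2) := fun z => by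
    rw [← ENNReal.ofReal_mul (by positivity), div_eq_inv_mul]
  simp_rw [hd]
  rw [lintegral_withDensity_eq_lintegral_mul _ (hDm.const_mul _)
    (Finset.measurable_sum _ fun σ _ => Finset.measurable_sum _ fun τ _ => hfm σ τ)]
  simp only [Pi.mul_apply, mul_assoc, Finset.mul_sum]
  have hT : ∀ (σ : Fin r ↪ Fin N) (τ : Fin s ↪ Fin N),
      Measurable fun z : (Fin N → ℝ) × (Fin N → ℝ) =>
        ENNReal.ofReal (S.D z.1 z.2) * f (z.1 ∘ σ, z.2 ∘ τ) := fun σ τ => hDm.mul (hfm σ τ)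
  have hT' : ∀ (σ : Fin r ↪ Fin N) (τ : Fin s ↪ Fin N),
      Measurable fun z : (Fin N → ℝ) × (Fin N → ℝ) => ENNReal.ofReal (((N.factorial : ℝ) ^ 2)⁻¹) *
        (ENNReal.ofReal (S.D z.1 z.2) * f (z.1 ∘ σ, z.2 ∘ τ)) := fun σ τ => (hT σ τ).const_mul _
  rw [lintegral_finsetSum _ fun σ _ => Finset.measurable_fun_sum _ fun τ _ => hT' σ τ]
  simp_rw [lintegral_finsetSum _ fun τ _ => hT' _ τ, lintegral_const_mul _ (hT _ _),
    S.lintegral_D_mul_comp_embedding hnn (Nat.add_sub_cancel' hr) (Nat.add_sub_cancel' hs) f hf]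
  simp only [Finset.sum_const, Finset.card_univ, Fintype.card_embedding_eq, Fintype.card_fin,
    nsmul_eq_mul]
  rw [← mul_assoc, ← mul_assoc, ← mul_assoc]
  conv_rhs => rw [← one_mul (∫⁻ w, _ ∂_)]
  congr 1
  rw [← ENNReal.ofReal_natCast, ← ENNReal.ofReal_natCast, ← ENNReal.ofReal_mul (by positivity),
    ← ENNReal.ofReal_mul (by positivity), ← ENNReal.ofReal_mul (by positivity),
    ← ENNReal.ofReal_one]
  congr 1
  -- There are `N! / (N-r)!` embeddings, each contributing the factor `(N-r)!`; likewise for `s`.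
  -- Together they cancel the normalisation `(N!)^2`.
  have h1 : ((N - r).factorial : ℝ) * N.descFactorial r = N.factorial := by
    exact_mod_cast Nat.factorial_mul_descFactorial hr
  have h2 : ((N - s).factorial : ℝ) * N.descFactorial s = N.factorial := by
    exact_mod_cast Nat.factorial_mul_descFactorial hs
  calc _ = (((N - r).factorial : ℝ) * N.descFactorial r) *
        (((N - s).factorial : ℝ) * N.descFactorial s) * ((N.factorial : ℝ) ^ 2)⁻¹ := by ring
    _ = 1 := by rw [h1, h2, ← sq, mul_inv_cancel₀ hN.ne']

end BiorthogonalSystem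

/-! ### The Cauchy–Laguerre bi-orthogonal system and its kernels -/

open Set

/-- These inequalities make `x ^ (a - s)` and `y ^ (b + s - 1)` integrable at zero. The conditions
on `a`, `b` and `a + b` are what make the interval from `max 0 (-b)` to `min 1 (a + 1)` nonempty. -/
theorem exists_exponent {a b : ℝ} (ha : -1 < a) (hb : -1 < b) (hab : -1 < a + b) :
    ∃ s : ℝ, 0 ≤ s ∧ s ≤ 1 ∧ s < a + 1 ∧ -b < s := by
  obtain ⟨s, h1, h2⟩ := exists_between (show max 0 (-b) < min 1 (a + 1) by
    simp only [lt_min_iff, max_lt_iff]; refine ⟨⟨?_, ?_⟩, ?_, ?_⟩ <;> linarith)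
  simp only [lt_min_iff, max_lt_iff] at h1 h2
  exact ⟨s, h1.1.le, h2.1.le, h2.2, h1.2⟩

theorem one_div_add_le_rpow_mul_rpow {x y s : ℝ} (hx : 0 < x) (hy : 0 < y) (hs : 0 ≤ s)
    (hs1 : s ≤ 1) : 1 / (x + y) ≤ x ^ (-s) * y ^ (s - 1) := by
  have h1 : x ^ s * y ^ (1 - s) ≤ x + y := by
    calc x ^ s * y ^ (1 - s) ≤ (x + y) ^ s * (x + y) ^ (1 - s) := by
          gcongr <;> linarith
      _ = x + y := by rw [← Real.rpow_add (by positivity)]; simp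
  have h2 : x ^ (-s) * y ^ (s - 1) = 1 / (x ^ s * y ^ (1 - s)) := by
    rw [Real.rpow_neg hx.le, show s - 1 = -(1 - s) by ring, Real.rpow_neg hy.le]
    field_simp
  rw [h2]
  exact one_div_le_one_div_of_le (by positivity) h1

/-- The kernel `1 / (x + y)` on the positive half-line, extended by zero. -/
def cauchyKernel (x y : ℝ) : ℝ := if 0 < x ∧ 0 < y then 1 / (x + y) else 0

theorem cauchyKernel_of_pos {x y : ℝ} (hx : 0 < x) (hy : 0 < y) :
    cauchyKernel x y = 1 / (x + y) := if_pos ⟨hx, hy⟩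

theorem measurable_cauchyKernel : Measurable (Function.uncurry cauchyKernel) := by
  refine Measurable.ite ?_ (by fun_prop) (by fun_prop)
  exact (measurableSet_lt measurable_const measurable_fst).inter
    (measurableSet_lt measurable_const measurable_snd)

/-- The absolute values on the right keep the bound valid off the positive quadrant, where the
kernel is zero but real powers may be negative. -/
theorem abs_cauchyKernel_le {s : ℝ} (hs : 0 ≤ s) (hs1 : s ≤ 1) (x y : ℝ) :
    |cauchyKernel x y| ≤ |x ^ (-s)| * |y ^ (s - 1)| := by
  unfold cauchyKernel
  split_ifs with h
  · obtain ⟨hx, hy⟩ := h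
    rw [abs_of_pos (by positivity), abs_of_pos (by positivity), abs_of_pos (by positivity)]
    exact one_div_add_le_rpow_mul_rpow hx hy hs hs1
  · simp only [abs_zero]; positivity

theorem measurable_weight (c : ℝ) : Measurable (weight c) := by
  unfold weight; fun_prop

theorem integrableOn_eval_mul_rpow {c θ : ℝ} (hc : -1 < c) (hθ : 0 < θ) (R : Polynomial ℝ) :
    IntegrableOn (fun x : ℝ => R.eval (x ^ θ) * (x ^ c * Real.exp (-x))) (Ioi 0) := by
  have h : EqOn (fun x : ℝ => ∑ l ∈ Finset.range (R.natDegree + 1),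
      R.coeff l * (x ^ (c + θ * l) * Real.exp (-(1 * x))))
      (fun x : ℝ => R.eval (x ^ θ) * (x ^ c * Real.exp (-x))) (Ioi 0) := by
    intro x hx
    simp only [Polynomial.eval_eq_sum_range, Finset.sum_mul]
    refine Finset.sum_congr rfl fun l _ => ?_
    rw [Real.rpow_add hx, Real.rpow_mul (le_of_lt hx), Real.rpow_natCast, one_mul]
    ring
  refine IntegrableOn.congr_fun (integrable_finsetSum _ fun l _ => ?_) h measurableSet_Ioi
  refine (integrableOn_rpow_mul_exp_neg_mul ?_ one_pos).const_mul _
  have : 0 ≤ θ * l := by positivity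
  linarith

theorem integrableOn_mul_weight_mul_rpow {c t θ : ℝ} (hc : -1 < c + t) (hθ : 0 < θ) (d : ℝ)
    (R : Polynomial ℝ) :
    IntegrableOn (fun x : ℝ => d * R.eval (x ^ θ) * weight c x * |x ^ t|) (Ioi 0) := by
  refine IntegrableOn.congr_fun ((integrableOn_eval_mul_rpow hc hθ R).const_mul d) ?_
    measurableSet_Ioi
  intro x hx
  have hx : 0 < x := hx
  simp only [weight]
  rw [abs_of_pos (by positivity), Real.rpow_add hx]
  ring

theorem hNorm_pos {a b θ : ℝ} (hab : -1 < a + b) (hθ : 0 < θ) (n : ℕ) : 0 < hNorm a b θ n := by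
  unfold hNorm
  have : 0 ≤ 2 * n * θ := by positivity
  exact div_pos hθ (by linarith)

/-- The system of functions attached to a pair of Cauchy bi-orthogonal families. -/
structure IsLaguerreSystem {N : ℕ} (S : BiorthogonalSystem (volume.restrict (Ioi (0 : ℝ))) N)
    (a b θ : ℝ) (P Q : ℕ → Polynomial ℝ) : Prop where
  C_eq : S.C = cauchyKernel
  p_eq : ∀ n x, S.p n x = θ / hNorm a b θ n * (P n).eval (x ^ θ) * weight a x
  q_eq : ∀ n y, S.q n y = (Q n).eval (y ^ θ) * weight b y

/-- Placing `θ / h_n` in `p` turns the pairing constant `h_n / θ` into one. The exponent `s`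
provides the majorants `φ` and `ψ`. -/
theorem exists_isLaguerreSystem {a b θ : ℝ} (ha : -1 < a) (hb : -1 < b) (hab : -1 < a + b)
    (hθ : 0 < θ) {P Q : ℕ → Polynomial ℝ} (h : IsCauchyBiorthogonal a b θ P Q) (N : ℕ) :
    ∃ S : BiorthogonalSystem (volume.restrict (Ioi (0 : ℝ))) N,
      IsLaguerreSystem S a b θ P Q := by
  obtain ⟨s, hs0, hs1, hsa, hsb⟩ := exists_exponent ha hb hab
  have hev : ∀ R : Polynomial ℝ, Measurable fun x : ℝ => R.eval (x ^ θ) := fun R =>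
    R.continuous.measurable.comp (by fun_prop)
  exact ⟨{
    C := cauchyKernel
    p := fun n x => θ / hNorm a b θ n * (P n).eval (x ^ θ) * weight a x
    q := fun n y => (Q n).eval (y ^ θ) * weight b y
    φ := fun x => |x ^ (-s)|
    ψ := fun y => |y ^ (s - 1)|
    measurable_C := measurable_cauchyKernel
    measurable_p := fun n => ((hev _).const_mul _).mul (measurable_weight a)
    measurable_q := fun n => (hev _).mul (measurable_weight b)
    abs_C_le := abs_cauchyKernel_le hs0 hs1
    integrable_p := fun n => integrableOn_mul_weight_mul_rpow (by linarith) hθ _ _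
    integrable_q := fun n => by
      have := integrableOn_mul_weight_mul_rpow (c := b) (t := s - 1) (by linarith) hθ 1 (Q n)
      simp only [one_mul] at this
      exact this
    biorthogonal := fun n m => by
      have hm : MeasurableSet (Ioi (0 : ℝ) ×ˢ Ioi (0 : ℝ)) :=
        measurableSet_Ioi.prod measurableSet_Ioi
      have h1 := h.2 n m
      have h2 : EqOn (fun z : ℝ × ℝ => θ / hNorm a b θ n * (P n).eval (z.1 ^ θ) * weight a z.1 *
          cauchyKernel z.1 z.2 * ((Q m).eval (z.2 ^ θ) * weight b z.2))
          (fun z : ℝ × ℝ => θ / hNorm a b θ n * (Real.exp (-(z.1 + z.2)) / (z.1 + z.2) *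
            z.1 ^ a * z.2 ^ b * (P n).eval (z.1 ^ θ) * (Q m).eval (z.2 ^ θ)))
          (Ioi (0 : ℝ) ×ˢ Ioi (0 : ℝ)) := by
        rintro ⟨x, y⟩ ⟨hx, hy⟩
        simp only [mem_Ioi] at hx hy
        simp only [weight, cauchyKernel_of_pos hx hy]
        rw [neg_add, Real.exp_add]
        ring
      rw [Measure.prod_restrict, ← Measure.volume_eq_prod, setIntegral_congr_fun hm h2,
        integral_const_mul, h1]
      have := hNorm_pos hab hθ (a := a) (b := b) n
      simp only [Fin.val_inj]
      split_ifs
      · field_simp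
      · simp }, rfl, fun _ _ => rfl, fun _ _ => rfl⟩

theorem K00_eq_sum_fin (a b θ : ℝ) (P Q : ℕ → Polynomial ℝ) (N : ℕ) (x y : ℝ) :
    K00 a b θ P Q N x y = ∑ n : Fin N,
      θ / hNorm a b θ n * (P n).eval (x ^ θ) * (Q n).eval (y ^ θ) := by
  rw [K00, Finset.sum_range]

namespace IsLaguerreSystem

variable {N : ℕ} {S : BiorthogonalSystem (volume.restrict (Ioi (0 : ℝ))) N}
  {a b θ : ℝ} {P Q : ℕ → Polynomial ℝ} (hS : IsLaguerreSystem S a b θ P Q)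

include hS

theorem C_of_pos {x y : ℝ} (hx : 0 < x) (hy : 0 < y) : S.C x y = 1 / (x + y) := by
  rw [hS.C_eq, cauchyKernel_of_pos hx hy]

theorem K01Integrand_eqOn (x : ℝ) {x' : ℝ} (hx' : 0 < x') :
    EqOn (fun y => ∑ n : Fin N, θ / hNorm a b θ n * (P n).eval (x ^ θ) * (S.q n y * S.C x' y))
      (K01Integrand a b θ P Q N x x') (Ioi 0) := by
  intro y hy
  simp only [K01Integrand, K00_eq_sum_fin, Finset.sum_div, Finset.sum_mul, hS.q_eq,
    hS.C_of_pos hx' hy]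
  exact Finset.sum_congr rfl fun n _ => by ring

theorem K10Integrand_eqOn {y : ℝ} (hy : 0 < y) (y' : ℝ) :
    EqOn (fun x => ∑ n : Fin N, (Q n).eval (y' ^ θ) * (S.p n x * S.C x y))
      (K10Integrand a b θ P Q N y y') (Ioi 0) := by
  intro x hx
  simp only [K10Integrand, K00_eq_sum_fin, Finset.sum_div, Finset.sum_mul, hS.p_eq,
    hS.C_of_pos hx hy]
  exact Finset.sum_congr rfl fun n _ => by ring

theorem K11Integrand_eqOn {y x : ℝ} (hy : 0 < y) (hx : 0 < x) :
    EqOn (fun z : ℝ × ℝ => ∑ n : Fin N, (S.p n z.1 * S.C z.1 y) * (S.q n z.2 * S.C x z.2))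
      (K11Integrand a b θ P Q N y x) (Ioi 0 ×ˢ Ioi 0) := by
  rintro ⟨x', y'⟩ ⟨hx', hy'⟩
  simp only [mem_Ioi] at hx' hy'
  simp only [K11Integrand, K00_eq_sum_fin, Finset.sum_div, Finset.sum_mul, hS.p_eq, hS.q_eq,
    hS.C_of_pos hx' hy, hS.C_of_pos hx hy']
  refine Finset.sum_congr rfl fun n _ => ?_
  have : x' + y ≠ 0 := by positivity
  have : x + y' ≠ 0 := by positivity
  field_simp

theorem kernelsConverge : KernelsConverge a b θ P Q N := by
  intro u v hu hv
  have hm : MeasurableSet (Ioi (0 : ℝ) ×ˢ Ioi (0 : ℝ)) := measurableSet_Ioi.prod measurableSet_Ioi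
  refine ⟨?_, ?_, ?_⟩
  · refine IntegrableOn.congr_fun ?_ (hS.K01Integrand_eqOn u hv) measurableSet_Ioi
    exact integrable_finsetSum _ fun n _ => (S.integrable_q_mul_C n v).const_mul _
  · refine IntegrableOn.congr_fun ?_ (hS.K10Integrand_eqOn hu v) measurableSet_Ioi
    exact integrable_finsetSum _ fun n _ => (S.integrable_p_mul_C n u).const_mul _
  · refine IntegrableOn.congr_fun ?_ (hS.K11Integrand_eqOn hu hv) hm
    rw [IntegrableOn, Measure.volume_eq_prod, ← Measure.prod_restrict]
    exact integrable_finsetSum _ fun n _ =>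
      (S.integrable_p_mul_C n u).mul_prod (S.integrable_q_mul_C n v)

theorem K01_eq (x : ℝ) {x' : ℝ} (hx' : 0 < x') :
    weight a x * K01 a b θ P Q N x x' = ∑ n, S.p n x * S.B n x' := by
  rw [K01, ← setIntegral_congr_fun measurableSet_Ioi (hS.K01Integrand_eqOn x hx'),
    integral_finsetSum _ fun n _ => (S.integrable_q_mul_C n x').const_mul _, Finset.mul_sum]
  refine Finset.sum_congr rfl fun n _ => ?_
  rw [integral_const_mul, hS.p_eq, BiorthogonalSystem.B]
  ring

theorem K10_eq {y : ℝ} (hy : 0 < y) (y' : ℝ) :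
    K10 a b θ P Q N y y' * weight b y' = ∑ n, S.A n y * S.q n y' := by
  rw [K10, ← setIntegral_congr_fun measurableSet_Ioi (hS.K10Integrand_eqOn hy y'),
    integral_finsetSum _ fun n _ => (S.integrable_p_mul_C n y).const_mul _, Finset.sum_mul]
  refine Finset.sum_congr rfl fun n _ => ?_
  rw [integral_const_mul, hS.q_eq, BiorthogonalSystem.A]
  ring

theorem K00_eq (x y : ℝ) :
    weight a x * K00 a b θ P Q N x y * weight b y = ∑ n, S.p n x * S.q n y := by
  rw [K00_eq_sum_fin, Finset.mul_sum, Finset.sum_mul]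
  exact Finset.sum_congr rfl fun n _ => by rw [hS.p_eq, hS.q_eq]; ring

theorem K11_eq {y x : ℝ} (hy : 0 < y) (hx : 0 < x) :
    K11 a b θ P Q N y x = ∑ n, S.A n y * S.B n x - S.C x y := by
  have hm : MeasurableSet (Ioi (0 : ℝ) ×ˢ Ioi (0 : ℝ)) := measurableSet_Ioi.prod measurableSet_Ioi
  rw [K11, ← setIntegral_congr_fun hm (hS.K11Integrand_eqOn hy hx), hS.C_of_pos hx hy,
    Measure.volume_eq_prod, ← Measure.prod_restrict, integral_finsetSum _ fun n _ =>
      (S.integrable_p_mul_C n y).mul_prod (S.integrable_q_mul_C n x)]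
  congr 1
  refine Finset.sum_congr rfl fun n _ => ?_
  rw [integral_prod_mul (fun u => S.p n u * S.C u y) (fun v => S.q n v * S.C x v)]
  rfl

/-- The two kernel matrices differ by scaling the rows of the first kind by `weight a` and the
columns of the second kind by `weight b`, which leaves the `K11` block unscaled. -/
theorem D_eq {r s : ℕ} {x : Fin r → ℝ} {y : Fin s → ℝ} (hx : x ∈ posOrthant r)
    (hy : y ∈ posOrthant s) :
    S.D x y = (∏ i, weight a (x i)) * (∏ j, weight b (y j)) *
      (kernelMatrix a b θ P Q N x y).det := by
  have h : S.kern x y = Matrix.diagonal (Sum.elim (fun i => weight a (x i)) fun _ => 1) *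
      kernelMatrix a b θ P Q N x y *
      Matrix.diagonal (Sum.elim (fun _ => 1) fun j => weight b (y j)) := by
    ext (i | i) (j | j) <;>
      simp [BiorthogonalSystem.kern, kernelMatrix, hS.K01_eq _ (hx _), hS.K10_eq (hy _),
        hS.K00_eq, hS.K11_eq (hy _) (hx _)]
  rw [BiorthogonalSystem.D, h, Matrix.det_mul, Matrix.det_mul, Matrix.det_diagonal,
    Matrix.det_diagonal, Fintype.prod_sum_type, Fintype.prod_sum_type]
  simp
  ring

end IsLaguerreSystem

/-! ### Density, normalisation and correlation functions of the model -/

theorem volume_restrict_posOrthant (n : ℕ) :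
    (volume : Measure (Fin n → ℝ)).restrict (posOrthant n) =
      Measure.pi fun _ => volume.restrict (Ioi (0 : ℝ)) := by
  rw [← Measure.restrict_pi_pi, volume_pi]
  congr 1
  ext x
  simp [posOrthant]

theorem volume_restrict_posOrthant_prod (m n : ℕ) :
    (volume : Measure ((Fin m → ℝ) × (Fin n → ℝ))).restrict (posOrthant m ×ˢ posOrthant n) =
      (Measure.pi fun _ => volume.restrict (Ioi (0 : ℝ))).prod
        (Measure.pi fun _ => volume.restrict (Ioi (0 : ℝ))) := by
  rw [Measure.volume_eq_prod, ← Measure.prod_restrict, volume_restrict_posOrthant,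
    volume_restrict_posOrthant]

theorem measurableSet_posOrthant (n : ℕ) : MeasurableSet (posOrthant n) := by
  have : posOrthant n = univ.pi fun _ => Ioi (0 : ℝ) := by ext x; simp [posOrthant]
  rw [this]
  exact MeasurableSet.univ_pi fun _ => measurableSet_Ioi

theorem measurableSet_posOrthant_prod (m n : ℕ) :
    MeasurableSet (posOrthant m ×ˢ posOrthant n) :=
  (measurableSet_posOrthant m).prod (measurableSet_posOrthant n)

/-- Since `t ↦ t ^ θ` is increasing, corresponding differences have the same sign. -/
theorem prodDiff_mul_prodDiff_rpow_nonneg {N : ℕ} {θ : ℝ} (hθ : 0 < θ) {x : Fin N → ℝ}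
    (hx : x ∈ posOrthant N) : 0 ≤ prodDiff x * prodDiff fun j => x j ^ θ := by
  unfold prodDiff
  rw [← Finset.prod_mul_distrib]
  refine Finset.prod_nonneg fun j _ => ?_
  rw [← Finset.prod_mul_distrib]
  refine Finset.prod_nonneg fun k _ => ?_
  rcases le_total (x j) (x k) with h | h
  · exact mul_nonneg (sub_nonneg.2 h) (sub_nonneg.2 (Real.rpow_le_rpow (hx j).le h hθ.le))
  · exact mul_nonneg_of_nonpos_of_nonpos (sub_nonpos.2 h)
      (sub_nonpos.2 (Real.rpow_le_rpow (hx k).le h hθ.le))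

theorem weight_pos (c : ℝ) {x : ℝ} (hx : 0 < x) : 0 < weight c x := by
  unfold weight; positivity

theorem density_nonneg {N : ℕ} (a b : ℝ) {θ : ℝ} (hθ : 0 < θ) {x y : Fin N → ℝ}
    (hx : x ∈ posOrthant N) (hy : y ∈ posOrthant N) : 0 ≤ density a b θ x y := by
  have h1 : 0 ≤ ∏ j, weight a (x j) * weight b (y j) :=
    Finset.prod_nonneg fun j _ => (mul_pos (weight_pos a (hx j)) (weight_pos b (hy j))).le
  have h2 : 0 ≤ ∏ j, ∏ k, (x j + y k) :=
    Finset.prod_nonneg fun j _ => Finset.prod_nonneg fun k _ => (add_pos (hx j) (hy k)).le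
  have h3 := prodDiff_mul_prodDiff_rpow_nonneg hθ hx
  have h4 := prodDiff_mul_prodDiff_rpow_nonneg hθ hy
  have : density a b θ x y = (∏ j, weight a (x j) * weight b (y j)) *
      ((prodDiff x * prodDiff fun j => x j ^ θ) * (prodDiff y * prodDiff fun j => y j ^ θ)) /
      ∏ j, ∏ k, (x j + y k) := by
    unfold density; ring
  rw [this]
  positivity

theorem density_eq_det {N : ℕ} (a b θ : ℝ) {x y : Fin N → ℝ}
    (hx : x ∈ posOrthant N) (hy : y ∈ posOrthant N) :
    density a b θ x y = (∏ j, weight a (x j)) * (∏ j, weight b (y j)) *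
      (prodDiff (fun j => x j ^ θ) * prodDiff (fun j => y j ^ θ) *
        (Matrix.of fun i j => 1 / (x i + y j)).det) := by
  rw [det_cauchy x y fun i j => (add_pos (hx i) (hy j)).ne', density, Finset.prod_mul_distrib]
  ring

/-- The vector `joinVars hr x x'` is a relabelling of the pair of vectors `x`, `x'`. -/
theorem joinVars_eq_sumElim_comp {r N : ℕ} (hr : r ≤ N) (x : Fin r → ℝ) (x' : Fin (N - r) → ℝ) :
    joinVars hr x x' =
      Sum.elim x x' ∘ (finSumFinEquiv.trans (finCongr (Nat.add_sub_cancel' hr))).symm := by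
  rw [← Equiv.comp_symm_eq, Equiv.symm_symm]
  ext (i | i) <;> simp [joinVars]

theorem joinVars_mem_posOrthant {r N : ℕ} (hr : r ≤ N) {x : Fin r → ℝ} {x' : Fin (N - r) → ℝ}
    (hx : x ∈ posOrthant r) (hx' : x' ∈ posOrthant (N - r)) : joinVars hr x x' ∈ posOrthant N := by
  intro i
  rw [joinVars_eq_sumElim_comp, Function.comp_apply]
  rcases (finSumFinEquiv.trans (finCongr (Nat.add_sub_cancel' hr))).symm i with j | j
  · exact hx j
  · exact hx' j

theorem prod_weight_joinVars {r N : ℕ} (hr : r ≤ N) (c : ℝ) (x : Fin r → ℝ)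
    (x' : Fin (N - r) → ℝ) :
    ∏ i, weight c (joinVars hr x x' i) = (∏ i, weight c (x i)) * ∏ i, weight c (x' i) := by
  simp only [joinVars_eq_sumElim_comp, Function.comp_apply]
  rw [Equiv.prod_comp _ fun i => weight c (Sum.elim x x' i), Fintype.prod_sum_type]
  rfl

/-- The constant relating the kernel determinant of all particles to the density. -/
def leadingConst (a b θ : ℝ) (P Q : ℕ → Polynomial ℝ) (N : ℕ) : ℝ :=
  (∏ n : Fin N, θ / hNorm a b θ n * (P n).coeff n) * ∏ n : Fin N, (Q n).coeff n

/-- The case with no frozen variable, where the remaining determinant is empty and equals one. -/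
theorem BiorthogonalSystem.integral_D_fin {N : ℕ}
    (S : BiorthogonalSystem (volume.restrict (Ioi (0 : ℝ))) N) :
    Integrable (fun z : (Fin N → ℝ) × (Fin N → ℝ) => S.D z.1 z.2)
      (volume.restrict (posOrthant N ×ˢ posOrthant N)) ∧
    ∫ z in posOrthant N ×ˢ posOrthant N, S.D z.1 z.2 = (N.factorial : ℝ) ^ 2 := by
  have hD : ∀ z : (Fin N → ℝ) × (Fin N → ℝ),
      S.D (Sum.elim (Fin.elim0 : Fin 0 → ℝ) z.1) (Sum.elim (Fin.elim0 : Fin 0 → ℝ) z.2) =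
        S.D z.1 z.2 := fun z => by
    rw [← S.D_comp_equiv z.1 z.2 (Equiv.emptySum (Fin 0) (Fin N)) (Equiv.emptySum (Fin 0) (Fin N))]
    congr 1 <;>
    · ext (i | i)
      · exact i.elim0
      · rfl
  have h1 := S.integrable_D_sumElim (Fin.elim0 : Fin 0 → ℝ) (Fin.elim0 : Fin 0 → ℝ)
    (Nat.zero_add N) (Nat.zero_add N)
  have h2 := S.integral_prod_D_sumElim (Fin.elim0 : Fin 0 → ℝ) (Fin.elim0 : Fin 0 → ℝ)
    (by simp) (by simp) h1
  simp_rw [hD] at h1 h2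
  rw [volume_restrict_posOrthant_prod]
  refine ⟨h1, h2.trans ?_⟩
  rw [BiorthogonalSystem.D, Matrix.det_isEmpty]
  ring

namespace IsLaguerreSystem

variable {N : ℕ} {S : BiorthogonalSystem (volume.restrict (Ioi (0 : ℝ))) N}
  {a b θ : ℝ} {P Q : ℕ → Polynomial ℝ} (hS : IsLaguerreSystem S a b θ P Q)

include hS

theorem D_fin_eq (hdeg : ∀ n, (P n).natDegree = n ∧ (Q n).natDegree = n) {x y : Fin N → ℝ}
    (hx : x ∈ posOrthant N) (hy : y ∈ posOrthant N) :
    S.D x y = leadingConst a b θ P Q N * density a b θ x y := by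
  have hp : (Matrix.of fun i n => S.p n (x i)).det = (∏ i, weight a (x i)) *
      ((∏ n : Fin N, θ / hNorm a b θ n * (P n).coeff n) * prodDiff fun j => x j ^ θ) := by
    have h1 := det_eval_eq_prod_coeff_mul_prodDiff (fun j => x j ^ θ)
      (fun n : Fin N => Polynomial.C (θ / hNorm a b θ n) * P n)
      (fun n => (Polynomial.natDegree_C_mul_le _ _).trans (hdeg n).1.le)
    simp only [Polynomial.coeff_C_mul] at h1
    rw [← h1, ← Matrix.det_mul_column]
    congr 1
    ext i n
    simp only [Matrix.of_apply, hS.p_eq, Polynomial.eval_mul, Polynomial.eval_C]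
    ring
  have hq : (Matrix.of fun i n => S.q n (y i)).det = (∏ i, weight b (y i)) *
      ((∏ n : Fin N, (Q n).coeff n) * prodDiff fun j => y j ^ θ) := by
    rw [← det_eval_eq_prod_coeff_mul_prodDiff (fun j => y j ^ θ) (fun n : Fin N => Q n)
      (fun n => (hdeg n).2.le), ← Matrix.det_mul_column]
    congr 1
    ext i n
    simp only [Matrix.of_apply, hS.q_eq]
    ring
  have hC : (Matrix.of fun i j => S.C (x i) (y j)) = Matrix.of fun i j => 1 / (x i + y j) := by
    ext i j; exact hS.C_of_pos (hx i) (hy j)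
  rw [S.D_fin, hp, hq, hC, density_eq_det a b θ hx hy, leadingConst]
  ring

/-- A nonpositive variable gives the matrix of `C` a zero row or column. This extends nonnegativity
of `D` to all arguments, as the factorial moment lemmas require. -/
theorem D_fin_eq_zero {x y : Fin N → ℝ} (h : ¬ (x ∈ posOrthant N ∧ y ∈ posOrthant N)) :
    S.D x y = 0 := by
  rw [S.D_fin]
  rw [not_and_or] at h
  have hdet : (Matrix.of fun i j => S.C (x i) (y j)).det = 0 := by
    rcases h with h | h
    · obtain ⟨i, hi⟩ : ∃ i, ¬ 0 < x i := by simpa [posOrthant] using h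
      exact Matrix.det_eq_zero_of_row_eq_zero i fun j => by simp [hS.C_eq, cauchyKernel, hi]
    · obtain ⟨j, hj⟩ : ∃ j, ¬ 0 < y j := by simpa [posOrthant] using h
      exact Matrix.det_eq_zero_of_column_eq_zero j fun i => by simp [hS.C_eq, cauchyKernel, hj]
  rw [hdet, mul_zero]

theorem leadingConst_mul_integral_density
    (hdeg : ∀ n, (P n).natDegree = n ∧ (Q n).natDegree = n) :
    leadingConst a b θ P Q N * ∫ z in posOrthant N ×ˢ posOrthant N, density a b θ z.1 z.2 =
      (N.factorial : ℝ) ^ 2 := by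
  rw [← S.integral_D_fin.2, ← integral_const_mul]
  exact setIntegral_congr_fun (measurableSet_posOrthant_prod N N) fun z hz =>
    (hS.D_fin_eq hdeg hz.1 hz.2).symm

theorem leadingConst_mul_partitionFunction
    (hdeg : ∀ n, (P n).natDegree = n ∧ (Q n).natDegree = n) :
    leadingConst a b θ P Q N * partitionFunction N a b θ = 1 := by
  have h := hS.leadingConst_mul_integral_density hdeg
  have hN : (N.factorial : ℝ) ≠ 0 := by positivity
  rw [partitionFunction, mul_left_comm, h]
  field_simp

/-- The constant times a nonnegative integral is `(N!)^2 > 0`, so no information on the signs of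
individual leading coefficients is needed. -/
theorem leadingConst_pos (hθ : 0 < θ) (hdeg : ∀ n, (P n).natDegree = n ∧ (Q n).natDegree = n) :
    0 < leadingConst a b θ P Q N := by
  have h := hS.leadingConst_mul_integral_density hdeg
  have h1 : 0 ≤ ∫ z in posOrthant N ×ˢ posOrthant N, density a b θ z.1 z.2 :=
    setIntegral_nonneg (measurableSet_posOrthant_prod N N) fun z hz =>
      density_nonneg a b hθ hz.1 hz.2
  have hN : (0 : ℝ) < (N.factorial : ℝ) ^ 2 := by positivity
  rw [← h] at hN
  exact pos_of_mul_pos_left hN h1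

theorem D_fin_nonneg (hθ : 0 < θ) (hdeg : ∀ n, (P n).natDegree = n ∧ (Q n).natDegree = n)
    (x y : Fin N → ℝ) : 0 ≤ S.D x y := by
  by_cases h : x ∈ posOrthant N ∧ y ∈ posOrthant N
  · rw [hS.D_fin_eq hdeg h.1 h.2]
    exact mul_nonneg (hS.leadingConst_pos hθ hdeg).le (density_nonneg a b hθ h.1 h.2)
  · rw [hS.D_fin_eq_zero h]

theorem density_div_eq (hdeg : ∀ n, (P n).natDegree = n ∧ (Q n).natDegree = n)
    {x y : Fin N → ℝ} (hx : x ∈ posOrthant N) (hy : y ∈ posOrthant N) :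
    density a b θ x y / ((N.factorial : ℝ) ^ 2 * partitionFunction N a b θ) =
      S.D x y / (N.factorial : ℝ) ^ 2 := by
  have h := hS.leadingConst_mul_partitionFunction hdeg
  have hZ : partitionFunction N a b θ ≠ 0 := right_ne_zero_of_mul_eq_one h
  have hN : (N.factorial : ℝ) ^ 2 ≠ 0 := by positivity
  rw [hS.D_fin_eq hdeg hx hy, div_eq_div_iff (mul_ne_zero hN hZ) hN]
  linear_combination -(density a b θ x y * (N.factorial : ℝ) ^ 2) * h

theorem law_eq (hdeg : ∀ n, (P n).natDegree = n ∧ (Q n).natDegree = n) :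
    law N a b θ = ((Measure.pi fun _ => volume.restrict (Ioi (0 : ℝ))).prod
      (Measure.pi fun _ => volume.restrict (Ioi (0 : ℝ)))).withDensity
        (fun z => ENNReal.ofReal (S.D z.1 z.2 / (N.factorial : ℝ) ^ 2)) := by
  rw [law, ← volume_restrict_posOrthant_prod]
  refine withDensity_congr_ae ?_
  filter_upwards [ae_restrict_mem (measurableSet_posOrthant_prod N N)] with z hz
  rw [hS.density_div_eq hdeg hz.1 hz.2]

theorem isProbabilityMeasure_law (hθ : 0 < θ)
    (hdeg : ∀ n, (P n).natDegree = n ∧ (Q n).natDegree = n) :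
    IsProbabilityMeasure (law N a b θ) := by
  obtain ⟨h1, h2⟩ := S.integral_D_fin
  rw [volume_restrict_posOrthant_prod] at h1 h2
  refine ⟨?_⟩
  rw [hS.law_eq hdeg, withDensity_apply _ MeasurableSet.univ, Measure.restrict_univ,
    ← ofReal_integral_eq_lintegral_ofReal (h1.div_const _) (Filter.Eventually.of_forall fun z =>
      div_nonneg (hS.D_fin_nonneg hθ hdeg _ _) (by positivity)), integral_div, h2,
    div_self (by positivity), ENNReal.ofReal_one]

theorem D_sumElim_eq (hdeg : ∀ n, (P n).natDegree = n ∧ (Q n).natDegree = n) {r s : ℕ}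
    (hr : r ≤ N) (hs : s ≤ N) {x : Fin r → ℝ} {y : Fin s → ℝ} (hx : x ∈ posOrthant r)
    (hy : y ∈ posOrthant s) {z : (Fin (N - r) → ℝ) × (Fin (N - s) → ℝ)}
    (hz : z ∈ posOrthant (N - r) ×ˢ posOrthant (N - s)) :
    S.D (Sum.elim x z.1) (Sum.elim y z.2) =
      leadingConst a b θ P Q N * ((∏ j, weight a (x j)) * ∏ j, weight b (y j)) *
        correlationIntegrand a b θ hr hs x y z := by
  have hX := joinVars_mem_posOrthant hr hx hz.1
  have hY := joinVars_mem_posOrthant hs hy hz.2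
  rw [← S.D_comp_equiv _ _ (finSumFinEquiv.trans (finCongr (Nat.add_sub_cancel' hr))).symm
    (finSumFinEquiv.trans (finCongr (Nat.add_sub_cancel' hs))).symm, ← joinVars_eq_sumElim_comp hr,
    ← joinVars_eq_sumElim_comp hs, hS.D_fin_eq hdeg hX hY, density_eq_det a b θ hX hY,
    prod_weight_joinVars, prod_weight_joinVars, correlationIntegrand]
  ring

theorem correlation_eq_D (hθ : 0 < θ)
    (hdeg : ∀ n, (P n).natDegree = n ∧ (Q n).natDegree = n) {r s : ℕ}
    (hr : r ≤ N) (hs : s ≤ N) {x : Fin r → ℝ} {y : Fin s → ℝ} (hx : x ∈ posOrthant r)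
    (hy : y ∈ posOrthant s) :
    IntegrableOn (correlationIntegrand a b θ hr hs x y)
      (posOrthant (N - r) ×ˢ posOrthant (N - s)) ∧
    correlation a b θ hr hs x y = S.D x y := by
  have hm := measurableSet_posOrthant_prod (N - r) (N - s)
  have hW : 0 < (∏ j, weight a (x j)) * ∏ j, weight b (y j) :=
    mul_pos (Finset.prod_pos fun j _ => weight_pos a (hx j))
      (Finset.prod_pos fun j _ => weight_pos b (hy j))
  have hκ := hS.leadingConst_pos hθ hdeg
  have hκZ := hS.leadingConst_mul_partitionFunction hdeg
  have hZ : partitionFunction N a b θ ≠ 0 := right_ne_zero_of_mul_eq_one hκZ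
  have h1 := S.integrable_D_sumElim x y (Nat.add_sub_cancel' hr) (Nat.add_sub_cancel' hs)
  have h2 := S.integral_prod_D_sumElim x y (by simpa using Nat.add_sub_cancel' hr)
    (by simpa using Nat.add_sub_cancel' hs) h1
  rw [← volume_restrict_posOrthant_prod] at h1 h2
  rw [setIntegral_congr_fun hm fun z hz => hS.D_sumElim_eq hdeg hr hs hx hy hz,
    integral_const_mul] at h2
  constructor
  · have h3 : IntegrableOn _ _ _ := h1
    refine ((IntegrableOn.congr_fun h3 (fun z hz => hS.D_sumElim_eq hdeg hr hs hx hy hz) hm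
      ).const_mul (leadingConst a b θ P Q N *
        ((∏ j, weight a (x j)) * ∏ j, weight b (y j)))⁻¹).congr
      (Filter.Eventually.of_forall fun z => ?_)
    exact inv_mul_cancel_left₀ (mul_pos hκ hW).ne' _
  · have hk : (0 : ℝ) < (N - r).factorial := by positivity
    have hl : (0 : ℝ) < (N - s).factorial := by positivity
    rw [correlation, div_mul_eq_mul_div,
      div_eq_iff (mul_ne_zero (mul_pos hk hl).ne' hZ)]
    -- Multiplying by `leadingConst` matches the integral in `h2`, and `leadingConst *
    -- partitionFunction = 1` removes the partition function.
    apply mul_left_cancel₀ hκ.ne'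
    linear_combination h2 - ((N - r).factorial * (N - s).factorial * S.D x y) * hκZ

theorem isCorrelationFunction_correlation (hθ : 0 < θ)
    (hdeg : ∀ n, (P n).natDegree = n ∧ (Q n).natDegree = n) {r s : ℕ} (hr : r ≤ N) (hs : s ≤ N) :
    IsCorrelationFunction (law N a b θ) r s (correlation a b θ hr hs) := by
  intro f hf
  rw [hS.law_eq hdeg, S.lintegral_sum_embedding (hS.D_fin_nonneg hθ hdeg) hr hs f hf,
    ← volume_restrict_posOrthant_prod]
  refine setLIntegral_congr_fun (measurableSet_posOrthant_prod r s) fun w hw => ?_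
  simp only [(hS.correlation_eq_D hθ hdeg hr hs hw.1 hw.2).2]

end IsLaguerreSystem

end CauchyLaguerre
end

theorem mainTheorem5 (a b θ : ℝ) (ha : -1 < a) (hb : -1 < b) (hab : -1 < a + b) (hθ : 0 < θ)
    (N : ℕ) :
    (∀ x ∈ CauchyLaguerre.posOrthant N, ∀ y ∈ CauchyLaguerre.posOrthant N,
      0 ≤ CauchyLaguerre.density a b θ x y) ∧
    MeasureTheory.IsProbabilityMeasure (CauchyLaguerre.law N a b θ) ∧
    CauchyLaguerre.IsCauchyBiorthogonal a b θ
      (CauchyLaguerre.PHat a b θ) (CauchyLaguerre.QHat a b θ) ∧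
    ∀ P Q : ℕ → Polynomial ℝ, CauchyLaguerre.IsCauchyBiorthogonal a b θ P Q →
      CauchyLaguerre.KernelsConverge a b θ P Q N ∧
      ∀ (r s : ℕ) (hr : r ≤ N) (hs : s ≤ N),
        CauchyLaguerre.IsCorrelationFunction (CauchyLaguerre.law N a b θ) r s
          (CauchyLaguerre.correlation a b θ hr hs) ∧
        ∀ x ∈ CauchyLaguerre.posOrthant r, ∀ y ∈ CauchyLaguerre.posOrthant s,
          MeasureTheory.IntegrableOn (CauchyLaguerre.correlationIntegrand a b θ hr hs x y)
            (CauchyLaguerre.posOrthant (N - r) ×ˢ CauchyLaguerre.posOrthant (N - s)) ∧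
          CauchyLaguerre.correlation a b θ hr hs x y =
            (∏ i, x i ^ a * Real.exp (-x i)) * (∏ j, y j ^ b * Real.exp (-y j)) *
              (CauchyLaguerre.kernelMatrix a b θ P Q N x y).det := by
  have hPQ := CauchyLaguerre.isCauchyBiorthogonal_PHat_QHat ha hb hab hθ
  refine ⟨fun x hx y hy => CauchyLaguerre.density_nonneg a b hθ hx hy, ?_, hPQ, ?_⟩
  -- The law does not involve the polynomials, so any one bi-orthogonal pair normalises it; the
  -- explicit pair shows that one exists.
  · obtain ⟨S, hS⟩ := CauchyLaguerre.exists_isLaguerreSystem ha hb hab hθ hPQ N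
    exact hS.isProbabilityMeasure_law hθ hPQ.1
  · intro P Q h
    obtain ⟨S, hS⟩ := CauchyLaguerre.exists_isLaguerreSystem ha hb hab hθ h N
    refine ⟨hS.kernelsConverge, fun r s hr hs =>
      ⟨hS.isCorrelationFunction_correlation hθ h.1 hr hs, fun x hx y hy => ?_⟩⟩
    obtain ⟨h1, h2⟩ := hS.correlation_eq_D hθ h.1 hr hs hx hy
    exact ⟨h1, h2.trans (hS.D_eq hx hy)⟩
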